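/- **Conventions.** For $x\in[p,q)$ and a function $U$ continuous on $[p,q]$, the lower right Laplace derivate of $U$ at $x$ is $\liminf_{s\to\infty}s^2\int_0^\delta e^{-su}[U(x+u)-U(x)]\,du$ with $0<\delta\le q-x$ (it does not depend on $\delta$); the lower left one at $x\in(p,q]$ is $\liminf_{s\to\infty}(-s^2)\int_0^\delta e^{-su}[U(x-u)-U(x)]\,du$ with $0<\delta\le x-p$; the upper derivates use $\limsup$. A *major function* of $g:[p,q]\to\mathbb R$ is a continuous $U:[p,q]\to\mathbb R$ with $U(p)=0$ whose lower Laplace derivates (both, one-sided at the end points) are $\ge g(x)$ for every $x\in[p,q]$; a *minor function* is a continuous $V$ with $V(p)=0$ whose upper Laplace derivates are $\le g(x)$ for every $x\in[p,q]$. The function $g$ is *Laplace integrable* on $[p,q]$ with integral $J\in\mathbb R$ if $\inf_U U(q)=\sup_V V(q)=J$. It is Laplace integrable on $[p,\infty]$ if it is so on $[p,c]$ for all $c\ge p$ and $\int_p^\infty g:=\lim_{c\to\infty}\int_p^c g$ exists in $\mathbb R$; $[-\infty,q]$ is analogous, and on $[-\infty,\infty]$ one requires integrability on $[-\infty,c]$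 and $[c,\infty]$ for some real $c$ and adds. As usual $\int_s^s g=0$ and $\int_s^t g=-\int_t^s g$. A function that is only defined almost everywhere is integrated through any extension of it. All integrals below are Laplace integrals. The *Laplace derivative* $LD_1g(x)=L\in\mathbb R$ of a function $g$ that is Laplace integrable near $x$ is the common value, if the limits exist and agree for some $\delta>0$, of $$\lim_{s\to\infty}s^2\int_0^\delta e^{-su}[g(x+u)-g(x)]\,du\quad\text{and}\quad\lim_{s\to\infty}(-s^2)\int_0^\delta e^{-su}[g(x-u)-g(x)]\,du ;$$ $LD_{1x}f(x,y)$ is the Laplace derivative of $f(\cdot,y)$ at $x$. For $[\alpha,\beta]\subseteq\overline{\mathbb R}$, a continuous $G:[\alpha,\beta]\to\mathbb R$ is an *LP-primitive* on $[\alpha,\beta]$ if $LD_1G$ exists a.e. on $[\alpha,\beta]$, is Laplace integrable on $[\alpha,\beta]$, and $\int_s^tLD_1G=G(t)-G(s)$ for all $s,t\in[\alpha,\beta]$. **Theorem.** Let $\alpha<\beta$ and $a<b$ be extended real numbers and let $f:[\alpha,\beta]\times[a,b]\to\mathbb R$, where $[\alpha,\beta],[a,b]\subseteq\overline{\mathbb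 R}$. Suppose that $f(\cdot,y)$ is an LP-primitive on $[\alpha,\beta]$ for a.e. $y\in(a,b)$, and that $\int_a^bf(x_0,y)\,dy$ exists for at least one $x_0\in[\alpha,\beta]$. Then the following are equivalent. 1. The integral $F(x)=\int_a^bf(x,y)\,dy$ exists for every $x\in[\alpha,\beta]$, $F$ is an LP-primitive on $[\alpha,\beta]$, and for a.e. $x\in(\alpha,\beta)$ the integral $\int_a^bLD_{1x}f(x,y)\,dy$ exists and $LD_1F(x)=\int_a^bLD_{1x}f(x,y)\,dy$. 2. For all $s,t\in[\alpha,\beta]$ both iterated integrals exist and $$\int_s^t\int_a^bLD_{1x}f(x,y)\,dy\,dx=\int_a^b\int_s^tLD_{1x}f(x,y)\,dx\,dy .$$ -/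

import Mathlib

open MeasureTheory Filter Topology Set

/-- The expression `s² ∫₀^δ e^{-st} [U(x+t) - U(x)] dt`. It is only used for functions `U` that are
continuous on `[x, x+δ]`, so the integral is an ordinary one. -/
noncomputable def laplaceQuotRight (U : ℝ → ℝ) (x δ s : ℝ) : ℝ :=
  s ^ 2 * ∫ t in (0 : ℝ)..δ, Real.exp (-s * t) * (U (x + t) - U x)

/-- The expression `-s² ∫₀^δ e^{-st} [U(x-t) - U(x)] dt`, for `U` continuous on `[x-δ, x]`. -/
noncomputable def laplaceQuotLeft (U : ℝ → ℝ) (x δ s : ℝ) : ℝ :=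
  -s ^ 2 * ∫ t in (0 : ℝ)..δ, Real.exp (-s * t) * (U (x - t) - U x)

/-- `U` is a major function of `f` on `[a, b]`: it is continuous, `U a = 0`, and its lower Laplace
derivate is at least `f x` at each `x ∈ [a, b]` (one-sided at the end points). The derivates do
not depend on `δ`. -/
def IsLaplaceMajor (f : ℝ → ℝ) (a b : ℝ) (U : ℝ → ℝ) : Prop :=
  ContinuousOn U (Icc a b) ∧ U a = 0 ∧
  (∀ x ∈ Ico a b, ∃ δ ∈ Ioc 0 (b - x),
    (f x : EReal) ≤ liminf (fun s : ℝ => (laplaceQuotRight U x δ s : EReal)) atTop) ∧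
  (∀ x ∈ Ioc a b, ∃ δ ∈ Ioc 0 (x - a),
    (f x : EReal) ≤ liminf (fun s : ℝ => (laplaceQuotLeft U x δ s : EReal)) atTop)

/-- `V` is a minor function of `f` on `[a, b]`: it is continuous, `V a = 0`, and its upper Laplace
derivate is at most `f x` at each `x ∈ [a, b]` (one-sided at the end points). -/
def IsLaplaceMinor (f : ℝ → ℝ) (a b : ℝ) (V : ℝ → ℝ) : Prop :=
  ContinuousOn V (Icc a b) ∧ V a = 0 ∧
  (∀ x ∈ Ico a b, ∃ δ ∈ Ioc 0 (b - x),
    limsup (fun s : ℝ => (laplaceQuotRight V x δ s : EReal)) atTop ≤ (f x : EReal)) ∧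
  (∀ x ∈ Ioc a b, ∃ δ ∈ Ioc 0 (x - a),
    limsup (fun s : ℝ => (laplaceQuotLeft V x δ s : EReal)) atTop ≤ (f x : EReal))

/-- `f` is Laplace integrable on the compact interval `[a, b]` (with `a ≤ b`) with integral `J`:
`J` is the infimum of `U b` over the major functions `U` and the supremum of `V b` over the minor
functions `V`. -/
def HasCompactLaplaceIntegral (f : ℝ → ℝ) (a b J : ℝ) : Prop :=
  IsGLB {r | ∃ U, IsLaplaceMajor f a b U ∧ r = U b} J ∧
  IsLUB {r | ∃ V, IsLaplaceMinor f a b V ∧ r = V b} J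

/-- `f` is Laplace integrable on `[a, ∞]` with integral `J`. -/
def HasLaplaceIntegralTop (f : ℝ → ℝ) (a J : ℝ) : Prop :=
  ∃ Φ : ℝ → ℝ, (∀ c, a ≤ c → HasCompactLaplaceIntegral f a c (Φ c)) ∧
    Tendsto Φ atTop (𝓝 J)

/-- `f` is Laplace integrable on `[-∞, b]` with integral `J`. -/
def HasLaplaceIntegralBot (f : ℝ → ℝ) (b J : ℝ) : Prop :=
  ∃ Φ : ℝ → ℝ, (∀ c, c ≤ b → HasCompactLaplaceIntegral f c b (Φ c)) ∧
    Tendsto Φ atBot (𝓝 J)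

/-- `f` is Laplace integrable on the interval `[s, t]` of extended reals, `s ≤ t`, with
integral `J`. Only the values of `f` at real points matter, and `∫_s^s f = 0`. -/
def HasLaplaceIntegralIcc (f : ℝ → ℝ) (s t : EReal) (J : ℝ) : Prop :=
  (s = t ∧ J = 0) ∨
  (∃ a b : ℝ, s = a ∧ t = b ∧ HasCompactLaplaceIntegral f a b J) ∨
  (∃ a : ℝ, s = a ∧ t = ⊤ ∧ HasLaplaceIntegralTop f a J) ∨
  (∃ b : ℝ, s = ⊥ ∧ t = b ∧ HasLaplaceIntegralBot f b J) ∨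
  (s = ⊥ ∧ t = ⊤ ∧ ∃ c J₁ J₂ : ℝ,
    HasLaplaceIntegralBot f c J₁ ∧ HasLaplaceIntegralTop f c J₂ ∧ J = J₁ + J₂)

/-- The oriented integral: `∫_s^t f` exists and equals `J`, with `∫_s^t f = -∫_t^s f`. -/
def HasLaplaceIntegral (f : ℝ → ℝ) (s t : EReal) (J : ℝ) : Prop :=
  (s ≤ t ∧ HasLaplaceIntegralIcc f s t J) ∨ (t ≤ s ∧ HasLaplaceIntegralIcc f t s (-J))

/-- The integral from `s` to `t` of an almost everywhere defined function. The function is given by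
its graph: `φ x v` says that it is defined at `x` with value `v`. The integral exists and equals
`J` if the function is defined at almost every point between `s` and `t`, and agrees there almost
everywhere with some `g` with `∫_s^t g = J`. -/
def HasLaplaceIntegralAE (φ : ℝ → ℝ → Prop) (s t : EReal) (J : ℝ) : Prop :=
  ∃ g : ℝ → ℝ, (∀ᵐ x : ℝ, min s t < (x : EReal) → (x : EReal) < max s t → φ x (g x)) ∧
    HasLaplaceIntegral g s t J

/-- `f` is Laplace differentiable at `x` with (finite) Laplace derivative `LD₁ f x = L`. The
integrals are Laplace integrals, and `f` is Laplace integrable near `x`. -/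
def HasLaplaceDeriv (f : ℝ → ℝ) (x L : ℝ) : Prop :=
  ∃ δ > 0, (∃ J, HasCompactLaplaceIntegral f (x - δ) (x + δ) J) ∧
    (∃ R : ℝ → ℝ,
      (∀ᶠ s in atTop, HasCompactLaplaceIntegral
        (fun t => Real.exp (-s * t) * (f (x + t) - f x)) 0 δ (R s)) ∧
      Tendsto (fun s => s ^ 2 * R s) atTop (𝓝 L)) ∧
    (∃ R : ℝ → ℝ,
      (∀ᶠ s in atTop, HasCompactLaplaceIntegral
        (fun t => Real.exp (-s * t) * (f (x - t) - f x)) 0 δ (R s)) ∧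
      Tendsto (fun s => -s ^ 2 * R s) atTop (𝓝 L))

/-- The graph of the Laplace derivative of a function on (a part of) the extended reals, at real
points. -/
def LaplaceDerivGraph (F : EReal → ℝ) (x L : ℝ) : Prop :=
  HasLaplaceDeriv (fun u : ℝ => F u) x L

/-- `F` is an LP-primitive on the interval `[α, β]` of extended reals: `F` is continuous there,
`LD₁ F` exists almost everywhere, is Laplace integrable on `[α, β]`, and
`∫_s^t LD₁ F = F t - F s` for all `s, t ∈ [α, β]`. -/
def IsLPPrimitive (F : EReal → ℝ) (α β : EReal) : Prop :=
  ContinuousOn F (Icc α β) ∧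
  (∀ᵐ x : ℝ, α < (x : EReal) → (x : EReal) < β → ∃ L, LaplaceDerivGraph F x L) ∧
  (∃ J, HasLaplaceIntegralAE (LaplaceDerivGraph F) α β J) ∧
  ∀ s ∈ Icc α β, ∀ t ∈ Icc α β, HasLaplaceIntegralAE (LaplaceDerivGraph F) s t (F t - F s)

/-- The graph of the partial Laplace derivative: `LD₁ₓ f (x, y)` exists and equals `L`. -/
def PartialLaplaceDeriv (f : EReal → EReal → ℝ) (x y L : ℝ) : Prop :=
  LaplaceDerivGraph (fun u : EReal => f u y) x L

/-! Let h(x) = ∫_a^b LD₁ₓf(x,y) dy. As f(·,y) is an LP-primitive, the inner integral ∫_s^t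
LD₁ₓf(x,y) dx is f(t,y) - f(s,y) for a.e. y. Given (1), both iterated integrals therefore equal F(t)
- F(s). Given (2), integrating these differences in y and adding the integral at x₀ produces F, and
F(t) - F(s) = ∫_s^t h. What remains is a fundamental theorem: an indefinite Laplace integral is
continuous, and its Laplace derivative is a.e. the integrand (`ae_hasLaplaceDeriv`).

For this, take majorants U_n of h whose increase exceeds that of the primitive Φ by less than
1/(n+1). Then w_n = U_n - Φ is monotone. Hence Φ is a uniform limit of the U_n, up to constants, and
by Lebesgue's theorem and Fatou's lemma liminf w_n' = 0 a.e. At such points Φ = U_n - w_n has lower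
Laplace derivates at least h; the same argument for -h bounds the upper ones.

The rest makes the almost-everywhere formulation meaningful. Majorants can be corrected on null sets
(`exists_laplaceMajorant_null`), so the integral ignores them. Laplace derivatives are unique
(`HasLaplaceDeriv.unique`): integration by parts against a majorant shows that the tail of a Laplace
transform decays even when the integrand is only Laplace integrable. Finally,
`hasLaplaceIntegral_iff` replaces integrals over extended intervals by primitives continuous up to
infinite end points. -/

/-! ### Laplace quotients of continuous increments. -/

/-- The Laplace quotient `s² ∫₀^δ e^{-st} k(t) dt` of an increment function `k`. -/
noncomputable def laplaceQuot (k : ℝ → ℝ) (δ s : ℝ) : ℝ :=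
  s ^ 2 * ∫ t in (0 : ℝ)..δ, Real.exp (-s * t) * k t

theorem laplaceQuotRight_eq (U : ℝ → ℝ) (x δ s : ℝ) :
    laplaceQuotRight U x δ s = laplaceQuot (fun t => U (x + t) - U x) δ s := rfl

/-- Moving the sign into the increment lets both sides of a point share one theory at `0+`. -/
theorem laplaceQuotLeft_eq (U : ℝ → ℝ) (x δ s : ℝ) :
    laplaceQuotLeft U x δ s = laplaceQuot (fun t => U x - U (x - t)) δ s := by
  unfold laplaceQuotLeft laplaceQuot
  rw [neg_mul, ← mul_neg, ← intervalIntegral.integral_neg]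
  congr 2
  ext t
  ring

theorem intervalIntegrable_exp_mul {k : ℝ → ℝ} {c d : ℝ} (hcd : c ≤ d)
    (hk : ContinuousOn k (Icc c d)) (s : ℝ) :
    IntervalIntegrable (fun t => Real.exp (-s * t) * k t) volume c d := by
  apply ContinuousOn.intervalIntegrable
  rw [uIcc_of_le hcd]
  exact (Continuous.continuousOn (by fun_prop)).mul hk

theorem laplaceQuot_add {k l : ℝ → ℝ} {δ : ℝ} (hδ : 0 ≤ δ) (hk : ContinuousOn k (Icc 0 δ))
    (hl : ContinuousOn l (Icc 0 δ)) (s : ℝ) :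
    laplaceQuot (fun t => k t + l t) δ s = laplaceQuot k δ s + laplaceQuot l δ s := by
  unfold laplaceQuot
  simp only [mul_add]
  rw [intervalIntegral.integral_add (intervalIntegrable_exp_mul hδ hk s)
    (intervalIntegrable_exp_mul hδ hl s), mul_add]

theorem laplaceQuot_const_mul (c : ℝ) (k : ℝ → ℝ) (δ s : ℝ) :
    laplaceQuot (fun t => c * k t) δ s = c * laplaceQuot k δ s := by
  unfold laplaceQuot
  simp only [mul_left_comm _ c]
  rw [intervalIntegral.integral_const_mul]
  ring

theorem laplaceQuot_neg (k : ℝ → ℝ) (δ s : ℝ) :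
    laplaceQuot (fun t => -k t) δ s = -laplaceQuot k δ s := by
  simpa using laplaceQuot_const_mul (-1) k δ s

theorem laplaceQuot_mono {k l : ℝ → ℝ} {δ : ℝ} (hδ : 0 ≤ δ) (hk : ContinuousOn k (Icc 0 δ))
    (hl : ContinuousOn l (Icc 0 δ)) (h : ∀ t ∈ Icc 0 δ, k t ≤ l t) (s : ℝ) :
    laplaceQuot k δ s ≤ laplaceQuot l δ s := by
  unfold laplaceQuot
  apply mul_le_mul_of_nonneg_left _ (sq_nonneg s)
  exact intervalIntegral.integral_mono_on hδ (intervalIntegrable_exp_mul hδ hk s)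
    (intervalIntegrable_exp_mul hδ hl s)
    fun t ht => mul_le_mul_of_nonneg_left (h t ht) (Real.exp_pos _).le

theorem tendsto_pow_mul_exp_neg_mul (n : ℕ) {c : ℝ} (hc : 0 < c) :
    Tendsto (fun s : ℝ => s ^ n * Real.exp (-s * c)) atTop (𝓝 0) := by
  have h := (Real.tendsto_pow_mul_exp_neg_atTop_nhds_zero n).comp
    (tendsto_id.atTop_mul_const hc)
  have h2 := h.const_mul ((c ^ n)⁻¹)
  rw [mul_zero] at h2
  refine h2.congr fun s => ?_
  simp only [Function.comp, id, neg_mul, mul_pow]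
  field_simp

/-- The asymptotic behaviour of the Laplace quotient does not depend on `δ`. -/
theorem tendsto_laplaceQuot_sub {k : ℝ → ℝ} {δ₁ δ₂ : ℝ} (h0 : 0 < δ₁) (h12 : δ₁ ≤ δ₂)
    (hk : ContinuousOn k (Icc 0 δ₂)) :
    Tendsto (fun s => laplaceQuot k δ₂ s - laplaceQuot k δ₁ s) atTop (𝓝 0) := by
  obtain ⟨M, hM⟩ := isCompact_Icc.exists_bound_of_continuousOn hk
  have hM0 : 0 ≤ M := (norm_nonneg _).trans (hM 0 ⟨le_rfl, h0.le.trans h12⟩)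
  have key : ∀ s : ℝ, 0 ≤ s → ‖laplaceQuot k δ₂ s - laplaceQuot k δ₁ s‖ ≤
      (s ^ 2 * Real.exp (-s * δ₁)) * (M * (δ₂ - δ₁)) := by
    intro s hs
    have hI1 := intervalIntegrable_exp_mul h0.le (hk.mono (Icc_subset_Icc_right h12)) s
    have hI2 := intervalIntegrable_exp_mul h12 (hk.mono (Icc_subset_Icc_left h0.le)) s
    have : laplaceQuot k δ₂ s - laplaceQuot k δ₁ s
        = s ^ 2 * ∫ t in δ₁..δ₂, Real.exp (-s * t) * k t := by
      unfold laplaceQuot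
      rw [← intervalIntegral.integral_add_adjacent_intervals hI1 hI2]
      ring
    rw [this, norm_mul, Real.norm_of_nonneg (sq_nonneg s), mul_assoc]
    apply mul_le_mul_of_nonneg_left _ (sq_nonneg s)
    have hb : ∀ t ∈ uIoc δ₁ δ₂, ‖Real.exp (-s * t) * k t‖ ≤ Real.exp (-s * δ₁) * M := by
      intro t ht
      rw [uIoc_of_le h12] at ht
      rw [norm_mul, Real.norm_of_nonneg (Real.exp_pos _).le]
      apply mul_le_mul _ (hM t ⟨h0.le.trans ht.1.le, ht.2⟩) (norm_nonneg _) (Real.exp_pos _).le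
      apply Real.exp_le_exp.2
      nlinarith [ht.1]
    refine (intervalIntegral.norm_integral_le_of_norm_le_const hb).trans ?_
    rw [abs_of_nonneg (sub_nonneg.2 h12), mul_assoc]
  refine squeeze_zero_norm' ((eventually_ge_atTop 0).mono key) ?_
  simpa using (tendsto_pow_mul_exp_neg_mul 2 h0).mul_const (M * (δ₂ - δ₁))

/-- The normalisation that makes Laplace derivatives extend ordinary ones. -/
theorem tendsto_laplaceQuot_id {δ : ℝ} (hδ : 0 < δ) :
    Tendsto (fun s => laplaceQuot (fun t => t) δ s) atTop (𝓝 1) := by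
  have key : ∀ s : ℝ, 0 < s → laplaceQuot (fun t => t) δ s
      = 1 - (s ^ 2 * Real.exp (-s * δ) * (δ / s) + s ^ 2 * Real.exp (-s * δ) * (1 / s ^ 2)) := by
    intro s hs
    have hd : ∀ t ∈ uIcc 0 δ, HasDerivAt
        (fun t => -(Real.exp (-s * t) * (t / s + 1 / s ^ 2))) (Real.exp (-s * t) * t) t := by
      intro t _
      have h1 : HasDerivAt (fun t => Real.exp (-s * t)) (Real.exp (-s * t) * (-s * 1)) t :=
        ((hasDerivAt_id t).const_mul (-s)).exp
      have h2 : HasDerivAt (fun t => t / s + 1 / s ^ 2) (1 / s) t :=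
        ((hasDerivAt_id t).div_const s).add_const _
      have : s ≠ 0 := hs.ne'
      refine (h1.mul h2).neg.congr_deriv ?_
      field_simp
      ring
    unfold laplaceQuot
    rw [intervalIntegral.integral_eq_sub_of_hasDerivAt hd
      (intervalIntegrable_exp_mul hδ.le continuousOn_id s)]
    simp only [mul_zero, Real.exp_zero, zero_div]
    field_simp
    ring
  have h1 := (tendsto_pow_mul_exp_neg_mul 2 hδ).mul
    ((tendsto_const_nhds (x := δ)).div_atTop tendsto_id)
  have h2 := (tendsto_pow_mul_exp_neg_mul 2 hδ).mul
    ((tendsto_const_nhds (x := (1 : ℝ))).div_atTop (tendsto_pow_atTop two_ne_zero))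
  have h3 := (h1.add h2).const_sub 1
  simp only [mul_zero, add_zero, sub_zero] at h3
  exact h3.congr' ((eventually_gt_atTop 0).mono fun s hs => (key s hs).symm)

/-! ### Lower Laplace derivates at `0+`. -/

/-- The lower Laplace derivate at `0+` of the increment function `k`, continuous near `0`, is at
least `m`. -/
def LaplaceLower (k : ℝ → ℝ) (m : ℝ) : Prop :=
  ∃ δ > 0, ContinuousOn k (Icc 0 δ) ∧ ∀ m' < m, ∀ᶠ s in atTop, m' < laplaceQuot k δ s

theorem LaplaceLower.of_le {k : ℝ → ℝ} {m δ₁ δ₂ : ℝ} (h0 : 0 < δ₁) (h12 : δ₁ ≤ δ₂)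
    (hk : ContinuousOn k (Icc 0 δ₂)) :
    (∀ m' < m, ∀ᶠ s in atTop, m' < laplaceQuot k δ₁ s) ↔
      ∀ m' < m, ∀ᶠ s in atTop, m' < laplaceQuot k δ₂ s := by
  have h := tendsto_laplaceQuot_sub h0 h12 hk
  constructor <;> intro H m' hm'
  · have h1 := h.eventually (lt_mem_nhds (show -((m - m') / 2) < 0 by linarith))
    filter_upwards [h1, H ((m + m') / 2) (by linarith)] with s hs1 hs2
    linarith
  · have h1 := h.eventually (gt_mem_nhds (show 0 < (m - m') / 2 by linarith))
    filter_upwards [h1, H ((m + m') / 2) (by linarith)] with s hs1 hs2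
    linarith

theorem LaplaceLower.eventually {k : ℝ → ℝ} {m δ : ℝ} (h : LaplaceLower k m) (hδ : 0 < δ)
    (hk : ContinuousOn k (Icc 0 δ)) : ∀ m' < m, ∀ᶠ s in atTop, m' < laplaceQuot k δ s := by
  obtain ⟨δ', h0, hk', H⟩ := h
  rcases le_total δ δ' with hle | hle
  · exact (LaplaceLower.of_le hδ hle hk').2 H
  · exact (LaplaceLower.of_le h0 hle hk).1 H

/-- Every smaller radius works too, so several increments can be treated on a common interval. -/
theorem LaplaceLower.eventually_le {k : ℝ → ℝ} {m : ℝ} (h : LaplaceLower k m) :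
    ∃ δ > 0, ContinuousOn k (Icc 0 δ) ∧ ∀ δ' > 0, δ' ≤ δ →
      ∀ m' < m, ∀ᶠ s in atTop, m' < laplaceQuot k δ' s := by
  obtain ⟨δ, h0, hk, H⟩ := h
  exact ⟨δ, h0, hk, fun δ' h' hle => (LaplaceLower.of_le h' hle hk).2 H⟩

theorem LaplaceLower.add {k l : ℝ → ℝ} {m n : ℝ} (hk : LaplaceLower k m)
    (hl : LaplaceLower l n) : LaplaceLower (fun t => k t + l t) (m + n) := by
  obtain ⟨δ₁, h1, hk1, H1⟩ := hk.eventually_le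
  obtain ⟨δ₂, h2, hk2, H2⟩ := hl.eventually_le
  have h0 : 0 < min δ₁ δ₂ := lt_min h1 h2
  have hk1' := hk1.mono (Icc_subset_Icc_right (min_le_left δ₁ δ₂))
  have hk2' := hk2.mono (Icc_subset_Icc_right (min_le_right δ₁ δ₂))
  refine ⟨min δ₁ δ₂, h0, hk1'.add hk2', fun m' hm' => ?_⟩
  filter_upwards [H1 _ h0 (min_le_left _ _) (m - (m + n - m') / 2) (by linarith),
    H2 _ h0 (min_le_right _ _) (n - (m + n - m') / 2) (by linarith)] with s hs1 hs2
  rw [laplaceQuot_add h0.le hk1' hk2']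
  linarith

theorem LaplaceLower.const_mul {k : ℝ → ℝ} {m c : ℝ} (hk : LaplaceLower k m) (hc : 0 < c) :
    LaplaceLower (fun t => c * k t) (c * m) := by
  obtain ⟨δ, h1, hk1, H1⟩ := hk
  refine ⟨δ, h1, hk1.const_smul c, fun m' hm' => ?_⟩
  filter_upwards [H1 (m' / c) (by rwa [div_lt_iff₀' hc])] with s hs
  rw [laplaceQuot_const_mul]
  rwa [div_lt_iff₀' hc] at hs

theorem LaplaceLower.mono {k l : ℝ → ℝ} {m n δ : ℝ} (hk : LaplaceLower k m) (hnm : n ≤ m)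
    (hδ : 0 < δ) (hl : ContinuousOn l (Icc 0 δ)) (h : ∀ t ∈ Icc 0 δ, k t ≤ l t) :
    LaplaceLower l n := by
  obtain ⟨δ₁, h1, hk1, H1⟩ := hk.eventually_le
  have h0 : 0 < min δ₁ δ := lt_min h1 hδ
  have hl' := hl.mono (Icc_subset_Icc_right (min_le_right δ₁ δ))
  have hk' := hk1.mono (Icc_subset_Icc_right (min_le_left δ₁ δ))
  refine ⟨min δ₁ δ, h0, hl', fun m' hm' => ?_⟩
  filter_upwards [H1 _ h0 (min_le_left _ _) m' (by linarith)] with s hs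
  exact hs.trans_le (laplaceQuot_mono h0.le hk' hl'
    (fun t ht => h t ⟨ht.1, ht.2.trans (min_le_right _ _)⟩) s)

theorem LaplaceLower.congr {k l : ℝ → ℝ} {m δ : ℝ} (hk : LaplaceLower k m)
    (hδ : 0 < δ) (h : ∀ t ∈ Icc 0 δ, k t = l t) : LaplaceLower l m := by
  obtain ⟨δ₁, h1, hk1, H1⟩ := hk
  have h0 : 0 < min δ₁ δ := lt_min h1 hδ
  refine LaplaceLower.mono ⟨δ₁, h1, hk1, H1⟩ le_rfl h0 (l := l) ?_
    (fun t ht => (h t ⟨ht.1, ht.2.trans (min_le_right _ _)⟩).le)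
  exact (hk1.mono (Icc_subset_Icc_right (min_le_left δ₁ δ))).congr
    fun t ht => (h t ⟨ht.1, ht.2.trans (min_le_right _ _)⟩).symm

theorem laplaceLower_linear (c : ℝ) : LaplaceLower (fun t => c * t) c := by
  refine ⟨1, one_pos, by fun_prop, fun m' hm' => ?_⟩
  have := (tendsto_laplaceQuot_id one_pos).const_mul c
  rw [mul_one] at this
  filter_upwards [this.eventually (lt_mem_nhds hm')] with s hs
  rwa [laplaceQuot_const_mul]

theorem laplaceLower_of_linear_le {k : ℝ → ℝ} {c δ : ℝ} (hδ : 0 < δ)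
    (hk : ContinuousOn k (Icc 0 δ)) (h : ∀ t ∈ Icc 0 δ, c * t ≤ k t) : LaplaceLower k c :=
  (laplaceLower_linear c).mono le_rfl hδ hk h

theorem LaplaceLower.of_forall_lt {k : ℝ → ℝ} {m : ℝ} (h : ∀ m' < m, LaplaceLower k m') :
    LaplaceLower k m := by
  obtain ⟨δ, h0, hk, -⟩ := h (m - 1) (by linarith)
  refine ⟨δ, h0, hk, fun m' hm' => ?_⟩
  exact (h ((m + m') / 2) (by linarith)).eventually h0 hk m' (by linarith)

/-- For each `c' < c` the increment lies above the line of slope `c'` near `0`, and Laplace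
quotients are monotone. -/
theorem laplaceLower_of_hasDerivWithinAt {k : ℝ → ℝ} {c δ : ℝ} (hδ : 0 < δ)
    (hk : ContinuousOn k (Icc 0 δ)) (hk0 : k 0 = 0) (h : HasDerivWithinAt k c (Ici 0) 0) :
    LaplaceLower k c := by
  refine LaplaceLower.of_forall_lt fun c' hc' => ?_
  have h1 := (h.isLittleO).def (show 0 < c - c' by linarith)
  obtain ⟨η, hη, H⟩ := Metric.mem_nhdsWithin_iff.1 h1
  have h0 : 0 < min δ (η / 2) := lt_min hδ (by linarith)
  refine laplaceLower_of_linear_le h0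
    (hk.mono (Icc_subset_Icc_right (min_le_left _ _))) fun t ht => ?_
  have ht2 : t ≤ η / 2 := ht.2.trans (min_le_right _ _)
  have := H (a := t) ⟨by
    rw [Metric.mem_ball, Real.dist_eq, sub_zero, abs_of_nonneg ht.1]; linarith, ht.1⟩
  simp only [hk0, sub_zero, smul_eq_mul, mem_ofPred_eq, Real.norm_eq_abs, abs_of_nonneg ht.1] at this
  have := (abs_le.1 this).1
  linarith

theorem LaplaceLower.nonpos_of_nonpos {k : ℝ → ℝ} {m δ : ℝ} (hk : LaplaceLower k m)
    (hδ : 0 < δ) (h : ∀ t ∈ Icc 0 δ, k t ≤ 0) : m ≤ 0 := by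
  by_contra! hm
  obtain ⟨δ₁, h1, hk1, H1⟩ := hk.mono le_rfl hδ (continuousOn_const (c := (0 : ℝ))) h
  obtain ⟨s, hs⟩ := (H1 0 hm).exists
  simp [laplaceQuot] at hs

/-! ### Major and minor functions as majorants. -/

theorem EReal.coe_le_liminf_coe_iff {Q : ℝ → ℝ} {m : ℝ} :
    (m : EReal) ≤ liminf (fun s : ℝ => (Q s : EReal)) atTop ↔
      ∀ m' < m, ∀ᶠ s in atTop, m' < Q s := by
  rw [le_liminf_iff]
  constructor
  · intro h m' hm'
    simpa using h m' (EReal.coe_lt_coe_iff.2 hm')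
  · intro h y hy
    obtain ⟨r, hr1, hr2⟩ := EReal.lt_iff_exists_real_btwn.1 hy
    filter_upwards [h r (EReal.coe_lt_coe_iff.1 hr2)] with s hs
    exact hr1.trans (EReal.coe_lt_coe_iff.2 hs)

theorem EReal.limsup_coe_le_coe_iff {Q : ℝ → ℝ} {m : ℝ} :
    limsup (fun s : ℝ => (Q s : EReal)) atTop ≤ (m : EReal) ↔
      ∀ m' < -m, ∀ᶠ s in atTop, m' < -Q s := by
  rw [limsup_le_iff]
  constructor
  · intro h m' hm'
    filter_upwards [h ((-m' : ℝ) : EReal) (EReal.coe_lt_coe_iff.2 (by linarith))] with s hs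
    linarith [EReal.coe_lt_coe_iff.1 hs]
  · intro h y hy
    obtain ⟨r, hr1, hr2⟩ := EReal.lt_iff_exists_real_btwn.1 hy
    filter_upwards [h (-r) (by linarith [EReal.coe_lt_coe_iff.1 hr1])] with s hs
    exact lt_trans (EReal.coe_lt_coe_iff.2 (by linarith)) hr2

theorem continuousOn_rightIncrement {U : ℝ → ℝ} {a b x δ : ℝ} (hU : ContinuousOn U (Icc a b))
    (hx : a ≤ x) (hδ : δ ≤ b - x) : ContinuousOn (fun t => U (x + t) - U x) (Icc 0 δ) :=
  (hU.comp (by fun_prop) fun t ht => ⟨by linarith [ht.1], by linarith [ht.2]⟩).sub continuousOn_const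

theorem continuousOn_leftIncrement {U : ℝ → ℝ} {a b x δ : ℝ} (hU : ContinuousOn U (Icc a b))
    (hx : x ≤ b) (hδ : δ ≤ x - a) : ContinuousOn (fun t => U x - U (x - t)) (Icc 0 δ) :=
  continuousOn_const.sub
    (hU.comp (by fun_prop) fun t ht => ⟨by linarith [ht.2], by linarith [ht.1]⟩)

/-- `U` is continuous on `[a, b]` with lower Laplace derivates at least `f` there: a major function
up to an additive constant. -/
structure IsLaplaceMajorant (f : ℝ → ℝ) (a b : ℝ) (U : ℝ → ℝ) : Prop where
  cont : ContinuousOn U (Icc a b)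
  right : ∀ x ∈ Ico a b, LaplaceLower (fun t => U (x + t) - U x) (f x)
  left : ∀ x ∈ Ioc a b, LaplaceLower (fun t => U x - U (x - t)) (f x)

theorem isLaplaceMajor_iff {f U : ℝ → ℝ} {a b : ℝ} :
    IsLaplaceMajor f a b U ↔ IsLaplaceMajorant f a b U ∧ U a = 0 := by
  constructor
  · rintro ⟨hc, h0, hr, hl⟩
    refine ⟨⟨hc, fun x hx => ?_, fun x hx => ?_⟩, h0⟩
    · obtain ⟨δ, hδ, h⟩ := hr x hx
      exact ⟨δ, hδ.1, continuousOn_rightIncrement hc hx.1 hδ.2,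
        EReal.coe_le_liminf_coe_iff.1 h⟩
    · obtain ⟨δ, hδ, h⟩ := hl x hx
      simp only [laplaceQuotLeft_eq] at h
      exact ⟨δ, hδ.1, continuousOn_leftIncrement hc hx.2 hδ.2,
        EReal.coe_le_liminf_coe_iff.1 h⟩
  · rintro ⟨⟨hc, hr, hl⟩, h0⟩
    refine ⟨hc, h0, fun x hx => ⟨b - x, ⟨sub_pos.2 hx.2, le_rfl⟩, ?_⟩,
      fun x hx => ⟨x - a, ⟨sub_pos.2 hx.1, le_rfl⟩, ?_⟩⟩
    · exact EReal.coe_le_liminf_coe_iff.2 ((hr x hx).eventually (sub_pos.2 hx.2)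
        (continuousOn_rightIncrement hc hx.1 le_rfl))
    · simp only [laplaceQuotLeft_eq]
      exact EReal.coe_le_liminf_coe_iff.2 ((hl x hx).eventually (sub_pos.2 hx.1)
        (continuousOn_leftIncrement hc hx.2 le_rfl))

theorem laplaceQuot_neg_sub (V : ℝ → ℝ) (p q : ℝ → ℝ) (δ s : ℝ) :
    -laplaceQuot (fun t => V (p t) - V (q t)) δ s
      = laplaceQuot (fun t => -V (p t) - -V (q t)) δ s := by
  rw [← laplaceQuot_neg]
  congr 1
  ext t
  ring

/-- Negation exchanges upper and lower derivates, so only majorants need to be studied. -/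
theorem isLaplaceMinor_iff {f V : ℝ → ℝ} {a b : ℝ} :
    IsLaplaceMinor f a b V ↔
      IsLaplaceMajorant (fun x => -f x) a b (fun x => -V x) ∧ V a = 0 := by
  constructor
  · rintro ⟨hc, h0, hr, hl⟩
    refine ⟨⟨hc.neg, fun x hx => ?_, fun x hx => ?_⟩, h0⟩
    · obtain ⟨δ, hδ, h⟩ := hr x hx
      have := EReal.limsup_coe_le_coe_iff.1 h
      simp only [laplaceQuotRight_eq, laplaceQuot_neg_sub V] at this
      exact ⟨δ, hδ.1, continuousOn_rightIncrement hc.neg hx.1 hδ.2, this⟩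
    · obtain ⟨δ, hδ, h⟩ := hl x hx
      have := EReal.limsup_coe_le_coe_iff.1 h
      simp only [laplaceQuotLeft_eq, laplaceQuot_neg_sub V] at this
      exact ⟨δ, hδ.1, continuousOn_leftIncrement hc.neg hx.2 hδ.2, this⟩
  · rintro ⟨⟨hc, hr, hl⟩, h0⟩
    have hcV : ContinuousOn V (Icc a b) :=
      hc.neg.congr fun x _ => (neg_neg (V x)).symm
    refine ⟨hcV, h0, fun x hx => ⟨b - x, ⟨sub_pos.2 hx.2, le_rfl⟩, ?_⟩,
      fun x hx => ⟨x - a, ⟨sub_pos.2 hx.1, le_rfl⟩, ?_⟩⟩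
    · rw [EReal.limsup_coe_le_coe_iff]
      simp only [laplaceQuotRight_eq, laplaceQuot_neg_sub V]
      exact (hr x hx).eventually (sub_pos.2 hx.2) (continuousOn_rightIncrement hc hx.1 le_rfl)
    · rw [EReal.limsup_coe_le_coe_iff]
      simp only [laplaceQuotLeft_eq, laplaceQuot_neg_sub V]
      exact (hl x hx).eventually (sub_pos.2 hx.1) (continuousOn_leftIncrement hc hx.2 le_rfl)

namespace IsLaplaceMajorant

variable {f g U W : ℝ → ℝ} {a b c d : ℝ}

theorem add (hU : IsLaplaceMajorant f a b U) (hW : IsLaplaceMajorant g a b W) :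
    IsLaplaceMajorant (fun x => f x + g x) a b (fun x => U x + W x) where
  cont := hU.cont.add hW.cont
  right x hx := ((hU.right x hx).add (hW.right x hx)).congr one_pos fun t _ => by ring
  left x hx := ((hU.left x hx).add (hW.left x hx)).congr one_pos fun t _ => by ring

theorem add_const (hU : IsLaplaceMajorant f a b U) (r : ℝ) :
    IsLaplaceMajorant f a b (fun x => U x + r) where
  cont := hU.cont.add continuousOn_const
  right x hx := (hU.right x hx).congr one_pos fun t _ => by ring
  left x hx := (hU.left x hx).congr one_pos fun t _ => by ring

theorem restrict (hU : IsLaplaceMajorant f a b U) (hac : a ≤ c) (hdb : d ≤ b) :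
    IsLaplaceMajorant f c d U where
  cont := hU.cont.mono (Icc_subset_Icc hac hdb)
  right x hx := hU.right x ⟨hac.trans hx.1, hx.2.trans_le hdb⟩
  left x hx := hU.left x ⟨hac.trans_lt hx.1, hx.2.trans hdb⟩

/-- At `c` the right increments see only `W` and the left ones only `U`, so no condition beyond `U c
= W c` arises there. -/
theorem glue (hU : IsLaplaceMajorant f a c U) (hW : IsLaplaceMajorant f c b W)
    (hac : a ≤ c) (hcb : c ≤ b) (hUW : U c = W c) :
    IsLaplaceMajorant f a b (fun x => if x ≤ c then U x else W x) := by
  have hge : ∀ x, c ≤ x → (if x ≤ c then U x else W x) = W x := by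
    intro x hx
    rcases hx.eq_or_lt with rfl | hx
    · simp [hUW]
    · simp [hx.not_ge]
  have hle : ∀ x, x ≤ c → (if x ≤ c then U x else W x) = U x := fun x hx => if_pos hx
  refine ⟨?_, fun x hx => ?_, fun x hx => ?_⟩
  · rw [← Icc_union_Icc_eq_Icc hac hcb]
    exact (hU.cont.congr fun x hx => hle x hx.2).union_of_isClosed
      (hW.cont.congr fun x hx => hge x hx.1) isClosed_Icc isClosed_Icc
  · rcases lt_or_ge x c with h | h
    · refine (hU.right x ⟨hx.1, h⟩).congr (sub_pos.2 h) fun t ht => ?_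
      rw [hle x h.le, hle (x + t) (by linarith [ht.2])]
    · refine (hW.right x ⟨h, hx.2⟩).congr one_pos fun t ht => ?_
      rw [hge x h, hge (x + t) (by linarith [ht.1])]
  · rcases le_or_gt x c with h | h
    · refine (hU.left x ⟨hx.1, h⟩).congr one_pos fun t ht => ?_
      rw [hle x h, hle (x - t) (by linarith [ht.1])]
    · refine (hW.left x ⟨h, hx.2⟩).congr (sub_pos.2 h) fun t ht => ?_
      rw [hge x h.le, hge (x - t) (by linarith [ht.2])]

/-- At a maximum point other than `b` the right increments are nonpositive, which contradicts a
positive lower derivate; so the maximum is at `b`. -/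
theorem le_of_pos (hU : IsLaplaceMajorant f a b U) (hf : ∀ x, 0 < f x) (hab : a ≤ b) :
    U a ≤ U b := by
  obtain ⟨x, hx, hmax⟩ := isCompact_Icc.exists_isMaxOn (nonempty_Icc.2 hab) hU.cont
  rcases hx.2.eq_or_lt with rfl | hxb
  · exact hmax ⟨le_rfl, hab⟩
  · have := (hU.right x ⟨hx.1, hxb⟩).nonpos_of_nonpos (sub_pos.2 hxb) fun t ht =>
      sub_nonpos.2 (hmax ⟨by linarith [hx.1, ht.1], by linarith [ht.2]⟩)
    exact absurd (hf x) this.not_gt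

theorem linear (c : ℝ) : IsLaplaceMajorant (fun _ => c) a b (fun x => c * x) where
  cont := by fun_prop
  right x _ := (laplaceLower_linear c).congr one_pos fun t _ => by ring
  left x _ := (laplaceLower_linear c).congr one_pos fun t _ => by ring

/-- A continuous function with nonnegative lower Laplace derivates is nondecreasing. -/
theorem le_of_zero (hU : IsLaplaceMajorant (fun _ => 0) a b U) (hab : a ≤ b) : U a ≤ U b := by
  -- Tilting by `ε * x` makes the derivates strictly positive.
  have h : ∀ ε : ℝ, 0 < ε → U a + ε * a ≤ U b + ε * b := fun ε hε =>
    (hU.add (linear ε)).le_of_pos (fun _ => by simpa using hε) hab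
  refine le_of_forall_pos_le_add fun η hη => ?_
  -- The `+ 1` keeps the denominator positive when `a = b`.
  have := h (η / (b - a + 1)) (div_pos hη (by linarith))
  have h2 : η / (b - a + 1) * (b - a) ≤ η := by
    rw [div_mul_eq_mul_div, div_le_iff₀ (by linarith)]
    nlinarith
  linarith [mul_sub (η / (b - a + 1)) b a]

theorem add_neg_le (hU : IsLaplaceMajorant f a b U)
    (hW : IsLaplaceMajorant (fun x => -f x) a b W) (hab : a ≤ b) : U a + W a ≤ U b + W b := by
  have := hU.add hW
  simp only [add_neg_cancel] at this
  exact this.le_of_zero hab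

end IsLaplaceMajorant

/-! ### The integral on compact intervals. -/

/-- The infimum of `U b - U a` over the majorants `U` of `f` on `[a, b]` is at most `J`. -/
def LaplaceUpperLE (f : ℝ → ℝ) (a b J : ℝ) : Prop :=
  ∀ ε > 0, ∃ U, IsLaplaceMajorant f a b U ∧ U b - U a < J + ε

/-- Symmetric form: two upper estimates, for `f` and for `-f`. That major functions dominate minor
ones is `IsLaplaceMajorant.add_neg_le`. -/
theorem hasCompactLaplaceIntegral_iff {f : ℝ → ℝ} {a b J : ℝ} (hab : a ≤ b) :
    HasCompactLaplaceIntegral f a b J ↔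
      LaplaceUpperLE f a b J ∧ LaplaceUpperLE (fun x => -f x) a b (-J) := by
  constructor
  · rintro ⟨h1, h2⟩
    constructor
    · intro ε hε
      obtain ⟨_, ⟨U, hU, rfl⟩, -, hlt⟩ := h1.exists_between (show J < J + ε by linarith)
      rw [isLaplaceMajor_iff] at hU
      exact ⟨U, hU.1, by rwa [hU.2, sub_zero]⟩
    · intro ε hε
      obtain ⟨_, ⟨V, hV, rfl⟩, hlt, -⟩ := h2.exists_between (show J - ε < J by linarith)
      rw [isLaplaceMinor_iff] at hV
      exact ⟨_, hV.1, by rw [hV.2]; linarith⟩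
  · rintro ⟨h1, h2⟩
    refine ⟨⟨?_, fun y hy => le_of_forall_pos_le_add fun ε hε => ?_⟩,
      ⟨?_, fun y hy => le_of_forall_pos_le_add fun ε hε => ?_⟩⟩
    · rintro _ ⟨U, hU, rfl⟩
      rw [isLaplaceMajor_iff] at hU
      refine le_of_forall_pos_le_add fun ε hε => ?_
      obtain ⟨W, hW, hW'⟩ := h2 ε hε
      linarith [hU.1.add_neg_le hW hab, hU.2]
    · obtain ⟨U, hU, hU'⟩ := h1 ε hε
      refine (hy ⟨fun x => U x + -U a, isLaplaceMajor_iff.2 ⟨hU.add_const _, by ring⟩, rfl⟩).trans ?_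
      linarith
    · rintro _ ⟨V, hV, rfl⟩
      rw [isLaplaceMinor_iff] at hV
      refine le_of_forall_pos_le_add fun ε hε => ?_
      obtain ⟨U, hU, hU'⟩ := h1 ε hε
      linarith [hU.add_neg_le hV.1 hab, hV.2]
    · obtain ⟨W, hW, hW'⟩ := h2 ε hε
      have := hy ⟨fun x => W a - W x, isLaplaceMinor_iff.2 ⟨?_, by ring⟩, rfl⟩
      · linarith
      · convert hW.add_const (-W a) using 2
        ring

theorem LaplaceUpperLE.add {f g : ℝ → ℝ} {a b J K : ℝ} (hJ : LaplaceUpperLE f a b J)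
    (hK : LaplaceUpperLE g a b K) : LaplaceUpperLE (fun x => f x + g x) a b (J + K) := by
  intro ε hε
  obtain ⟨U, hU, hU'⟩ := hJ (ε / 2) (by linarith)
  obtain ⟨W, hW, hW'⟩ := hK (ε / 2) (by linarith)
  exact ⟨_, hU.add hW, by linarith⟩

theorem LaplaceUpperLE.concat {f : ℝ → ℝ} {a b c J K : ℝ} (hJ : LaplaceUpperLE f a c J)
    (hK : LaplaceUpperLE f c b K) (hac : a ≤ c) (hcb : c ≤ b) :
    LaplaceUpperLE f a b (J + K) := by
  intro ε hε
  obtain ⟨U, hU, hU'⟩ := hJ (ε / 2) (by linarith)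
  obtain ⟨W, hW, hW'⟩ := hK (ε / 2) (by linarith)
  refine ⟨_, hU.glue (hW.add_const (U c - W c)) hac hcb (by ring), ?_⟩
  rcases hcb.eq_or_lt with rfl | h
  · simp only [hac, le_refl, if_true]; linarith
  · simp only [hac, h.not_ge, if_true, if_false]; linarith

namespace HasCompactLaplaceIntegral

variable {f g : ℝ → ℝ} {a b c d J K : ℝ}

theorem unique (h1 : HasCompactLaplaceIntegral f a b J) (h2 : HasCompactLaplaceIntegral f a b K) :
    J = K := h1.1.unique h2.1

theorem neg (h : HasCompactLaplaceIntegral f a b J) (hab : a ≤ b) :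
    HasCompactLaplaceIntegral (fun x => -f x) a b (-J) := by
  rw [hasCompactLaplaceIntegral_iff hab] at h ⊢
  simpa using h.symm

theorem add (h1 : HasCompactLaplaceIntegral f a b J) (h2 : HasCompactLaplaceIntegral g a b K)
    (hab : a ≤ b) : HasCompactLaplaceIntegral (fun x => f x + g x) a b (J + K) := by
  rw [hasCompactLaplaceIntegral_iff hab] at h1 h2 ⊢
  refine ⟨h1.1.add h2.1, ?_⟩
  simp only [neg_add]
  exact h1.2.add h2.2

theorem concat (h1 : HasCompactLaplaceIntegral f a c J) (h2 : HasCompactLaplaceIntegral f c b K)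
    (hac : a ≤ c) (hcb : c ≤ b) : HasCompactLaplaceIntegral f a b (J + K) := by
  rw [hasCompactLaplaceIntegral_iff hac] at h1
  rw [hasCompactLaplaceIntegral_iff hcb] at h2
  rw [hasCompactLaplaceIntegral_iff (hac.trans hcb)]
  refine ⟨h1.1.concat h2.1 hac hcb, ?_⟩
  rw [neg_add]
  exact h1.2.concat h2.2 hac hcb

/-- For majorants `U` of `f` and `W` of `-f`, the sum `U + W` is nondecreasing, so its increase over
the subinterval is at most its total increase, which can be made arbitrarily small. -/
theorem restrict (h : HasCompactLaplaceIntegral f a b J) (hac : a ≤ c) (hcd : c ≤ d)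
    (hdb : d ≤ b) : ∃ K, HasCompactLaplaceIntegral f c d K := by
  rw [hasCompactLaplaceIntegral_iff (hac.trans (hcd.trans hdb))] at h
  have hlow : ∀ ε > 0, ∃ W, IsLaplaceMajorant (fun x => -f x) c d W ∧
      ∃ U, IsLaplaceMajorant f c d U ∧ U d - U c + (W d - W c) < ε := by
    intro ε hε
    obtain ⟨U, hU, hU'⟩ := h.1 (ε / 2) (by linarith)
    obtain ⟨W, hW, hW'⟩ := h.2 (ε / 2) (by linarith)
    refine ⟨W, hW.restrict hac hdb, U, hU.restrict hac hdb, ?_⟩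
    linarith [(hU.restrict le_rfl (hcd.trans hdb)).add_neg_le
      (hW.restrict le_rfl (hcd.trans hdb)) hac,
      (hU.restrict (hac.trans hcd) le_rfl).add_neg_le (hW.restrict (hac.trans hcd) le_rfl) hdb]
  set S : Set ℝ := {r | ∃ U, IsLaplaceMajorant f c d U ∧ r = U d - U c} with hS
  obtain ⟨W₀, hW₀, U₀, hU₀, -⟩ := hlow 1 one_pos
  have hbdd : BddBelow S := ⟨-(W₀ d - W₀ c), by
    rintro _ ⟨U, hU, rfl⟩
    linarith [hU.add_neg_le hW₀ hcd]⟩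
  have hne : S.Nonempty := ⟨_, U₀, hU₀, rfl⟩
  refine ⟨sInf S, (hasCompactLaplaceIntegral_iff hcd).2 ⟨fun ε hε => ?_, fun ε hε => ?_⟩⟩
  · obtain ⟨_, ⟨U, hU, rfl⟩, hlt⟩ := exists_lt_of_csInf_lt hne (show sInf S < sInf S + ε by linarith)
    exact ⟨U, hU, hlt⟩
  · obtain ⟨W, hW, U, hU, hlt⟩ := hlow ε hε
    exact ⟨W, hW, by linarith [csInf_le hbdd ⟨U, hU, rfl⟩]⟩

end HasCompactLaplaceIntegral

/-! ### Null sets. -/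

/-- Majorants may be corrected on a null set at arbitrarily small cost. -/
theorem exists_laplaceMajorant_null {f : ℝ → ℝ} {E : Set ℝ} (hE : volume E = 0) (a b : ℝ)
    (hab : a ≤ b) {ε : ℝ} (hε : 0 < ε) (hf : ∀ x ∉ E, f x ≤ 0) :
    ∃ σ, IsLaplaceMajorant f a b σ ∧ σ b - σ a < ε := by
  -- Vitali–Carathéodory: a lower semicontinuous `g`, infinite on `E`, with integral at most `ε /
  -- 2`. Its primitive `σ` is the correction.
  obtain ⟨g, hg, hlsc, hint⟩ := exists_le_lowerSemicontinuous_lintegral_ge volume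
    ((toMeasurable volume E).indicator fun _ => (⊤ : ENNReal))
    (measurable_const.indicator (measurableSet_toMeasurable _ _))
    (ε := ENNReal.ofReal (ε / 2)) (by simpa using hε)
  rw [lintegral_indicator (measurableSet_toMeasurable _ _), setLIntegral_const,
    measure_toMeasurable, hE, mul_zero, zero_add] at hint
  have hfin : ∫⁻ x, g x ≠ ⊤ := (hint.trans_lt ENNReal.ofReal_lt_top).ne
  have hgm : Measurable g := hlsc.measurable
  have hgi : Integrable (fun x => (g x).toReal) :=
    integrable_toReal_of_lintegral_ne_top hgm.aemeasurable hfin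
  have hgt : ∀ᵐ x, g x < ⊤ := ae_lt_top hgm hfin
  have hgE : ∀ x ∈ E, g x = ⊤ := fun x hx => by
    have := hg x
    rwa [indicator_of_mem (subset_toMeasurable _ _ hx), top_le_iff] at this
  have hii : ∀ c d, IntervalIntegrable (fun x => (g x).toReal) volume c d :=
    fun c d => hgi.intervalIntegrable
  set σ : ℝ → ℝ := fun x => ∫ t in a..x, (g t).toReal with hσ
  have hsub : ∀ x y, σ y - σ x = ∫ t in x..y, (g t).toReal := fun x y =>
    intervalIntegral.integral_interval_sub_left (hii _ _) (hii _ _)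
  have hcont : Continuous σ := intervalIntegral.continuous_primitive hii a
  have hnn : ∀ x y, x ≤ y → 0 ≤ σ y - σ x := fun x y hxy => by
    rw [hsub]
    exact intervalIntegral.integral_nonneg hxy fun _ _ => ENNReal.toReal_nonneg
  -- Semicontinuity makes `g` exceed any `N` near a point of `E`, so `σ` has slope at least `N`
  -- there, whatever value `f` takes.
  have hloc : ∀ x ∈ E, ∀ N : ℝ, ∃ η > 0, ∀ c d, c ≤ d → x - η ≤ c → d ≤ x + η →
      N * (d - c) ≤ σ d - σ c := by
    intro x hx N
    have h1 : ∀ᶠ y in 𝓝 x, ENNReal.ofReal N < g y :=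
      hlsc x _ (show ENNReal.ofReal N < g x by rw [hgE x hx]; exact ENNReal.ofReal_lt_top)
    obtain ⟨η, hη, H⟩ := Metric.eventually_nhds_iff.1 h1
    refine ⟨η / 2, by linarith, fun c d hcd hc hd => ?_⟩
    rw [hsub]
    calc N * (d - c) = ∫ _t in c..d, N := by simp [mul_comm]
      _ ≤ _ := by
        refine intervalIntegral.integral_mono_ae_restrict hcd (by simp) (hii _ _) ?_
        filter_upwards [ae_restrict_of_ae hgt, ae_restrict_mem measurableSet_Icc] with t ht htm
        have : ENNReal.ofReal N < g t := H (by
          rw [Real.dist_eq, abs_lt]; constructor <;> linarith [htm.1, htm.2])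
        exact (ENNReal.ofReal_le_iff_le_toReal ht.ne).1 this.le
  refine ⟨σ, ⟨hcont.continuousOn, fun x _ => ?_, fun x _ => ?_⟩, ?_⟩
  · have hc : ContinuousOn (fun t => σ (x + t) - σ x) (Icc 0 1) := by fun_prop
    by_cases hx : x ∈ E
    · obtain ⟨η, hη, H⟩ := hloc x hx (f x)
      refine laplaceLower_of_linear_le hη (by fun_prop) fun t ht => ?_
      simpa using H x (x + t) (by linarith [ht.1]) (by linarith) (by linarith [ht.2])
    · refine ((laplaceLower_linear 0).mono (hf x hx) one_pos hc fun t ht => ?_)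
      simpa using hnn x (x + t) (by linarith [ht.1])
  · have hc : ContinuousOn (fun t => σ x - σ (x - t)) (Icc 0 1) := by fun_prop
    by_cases hx : x ∈ E
    · obtain ⟨η, hη, H⟩ := hloc x hx (f x)
      refine laplaceLower_of_linear_le hη (by fun_prop) fun t ht => ?_
      simpa using H (x - t) x (by linarith [ht.1]) (by linarith [ht.2]) (by linarith)
    · refine ((laplaceLower_linear 0).mono (hf x hx) one_pos hc fun t ht => ?_)
      simpa using hnn (x - t) x (by linarith [ht.1])
  · rw [hsub, intervalIntegral.integral_of_le hab]
    refine lt_of_le_of_lt ((setIntegral_le_integral hgi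
      (ae_of_all _ fun _ => ENNReal.toReal_nonneg))) ?_
    rw [integral_toReal hgm.aemeasurable hgt]
    exact (ENNReal.toReal_le_of_le_ofReal (by linarith) hint).trans_lt (by linarith)

theorem LaplaceUpperLE.congr_ae {f g : ℝ → ℝ} {a b J : ℝ} (hab : a ≤ b)
    (h : LaplaceUpperLE f a b J) (hfg : ∀ᵐ x : ℝ, a < x → x < b → f x = g x) :
    LaplaceUpperLE g a b J := by
  classical
  have hE : volume {x | a ≤ x ∧ x ≤ b ∧ f x ≠ g x} = 0 := by
    have : ∀ᵐ x : ℝ, ¬ (a ≤ x ∧ x ≤ b ∧ f x ≠ g x) := by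
      filter_upwards [hfg, Measure.ae_ne volume a, Measure.ae_ne volume b] with x hx ha hb
      rintro ⟨h1, h2, h3⟩
      exact h3 (hx (lt_of_le_of_ne h1 ha.symm) (lt_of_le_of_ne h2 hb))
    simpa [ae_iff] using this
  intro ε hε
  obtain ⟨U, hU, hU'⟩ := h (ε / 2) (by linarith)
  obtain ⟨σ, hσ, hσ'⟩ := exists_laplaceMajorant_null hE a b hab (show 0 < ε / 2 by linarith)
    -- This function vanishes off `E`. The set `E` may contain the end points, where no agreement of
    -- `f` and `g` is assumed.
    (f := fun x => if a ≤ x ∧ x ≤ b then g x - f x else 0) fun x hx => by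
      by_cases hx2 : a ≤ x ∧ x ≤ b
      · have : f x = g x := by
          by_contra h3
          exact hx ⟨hx2.1, hx2.2, h3⟩
        simp [this]
      · simp [hx2]
  have hadd := hU.add hσ
  refine ⟨fun x => U x + σ x, ⟨hadd.cont, fun x hx => ?_, fun x hx => ?_⟩, by linarith⟩
  · simpa [hx.1, hx.2.le] using hadd.right x hx
  · simpa [hx.1.le, hx.2] using hadd.left x hx

theorem HasCompactLaplaceIntegral.congr_ae {f g : ℝ → ℝ} {a b J : ℝ} (hab : a ≤ b)
    (h : HasCompactLaplaceIntegral f a b J) (hfg : ∀ᵐ x : ℝ, a < x → x < b → f x = g x) :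
    HasCompactLaplaceIntegral g a b J := by
  rw [hasCompactLaplaceIntegral_iff hab] at h ⊢
  refine ⟨h.1.congr_ae hab hfg, h.2.congr_ae hab (hfg.mono fun x hx h1 h2 => ?_)⟩
  rw [hx h1 h2]

/-! ### Ordinary derivatives and continuous integrands. -/

theorem laplaceLower_right_of_hasDerivWithinAt {U : ℝ → ℝ} {a b x c : ℝ}
    (hc : ContinuousOn U (Icc a b)) (hx : x ∈ Ico a b)
    (h : HasDerivWithinAt U c (Icc a b) x) : LaplaceLower (fun t => U (x + t) - U x) c := by
  refine laplaceLower_of_hasDerivWithinAt (sub_pos.2 hx.2)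
    (continuousOn_rightIncrement hc hx.1 le_rfl) (by simp) ?_
  have h1 : HasDerivWithinAt (fun t => x + t) 1 (Icc 0 (b - x)) 0 :=
    (hasDerivAt_id 0).const_add x |>.hasDerivWithinAt
  have h2 := (HasDerivWithinAt.scomp (g₁ := U) (h := fun t => x + t) (t' := Icc a b) 0
    (g₁' := c) (by simpa using h) h1
    fun t ht => ⟨by linarith [ht.1, hx.1], by linarith [ht.2]⟩).sub_const (U x)
  rw [one_smul] at h2
  exact h2.mono_of_mem_nhdsWithin (Icc_mem_nhdsGE (sub_pos.2 hx.2))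

theorem laplaceLower_left_of_hasDerivWithinAt {U : ℝ → ℝ} {a b x c : ℝ}
    (hc : ContinuousOn U (Icc a b)) (hx : x ∈ Ioc a b)
    (h : HasDerivWithinAt U c (Icc a b) x) : LaplaceLower (fun t => U x - U (x - t)) c := by
  refine laplaceLower_of_hasDerivWithinAt (sub_pos.2 hx.1)
    (continuousOn_leftIncrement hc hx.2 le_rfl) (by simp) ?_
  have h1 : HasDerivWithinAt (fun t => x - t) (-1) (Icc 0 (x - a)) 0 :=
    (hasDerivAt_id 0).const_sub x |>.hasDerivWithinAt
  have h2 := (HasDerivWithinAt.scomp (g₁ := U) (h := fun t => x - t) (t' := Icc a b) 0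
    (g₁' := c) (by simpa using h) h1
    fun t ht => ⟨by linarith [ht.2], by linarith [ht.1, hx.2]⟩).const_sub (U x)
  simp only [smul_eq_mul, neg_mul, one_mul, neg_neg] at h2
  exact h2.mono_of_mem_nhdsWithin (Icc_mem_nhdsGE (sub_pos.2 hx.1))

theorem isLaplaceMajorant_of_hasDerivWithinAt {f U : ℝ → ℝ} {a b : ℝ}
    (hc : ContinuousOn U (Icc a b)) (h : ∀ x ∈ Icc a b, HasDerivWithinAt U (f x) (Icc a b) x) :
    IsLaplaceMajorant f a b U :=
  ⟨hc, fun x hx => laplaceLower_right_of_hasDerivWithinAt hc hx (h x (Ico_subset_Icc_self hx)),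
    fun x hx => laplaceLower_left_of_hasDerivWithinAt hc hx (h x (Ioc_subset_Icc_self hx))⟩

/-- Here `U` itself is a majorant of `f`, and `-U` one of `-f`. -/
theorem hasCompactLaplaceIntegral_of_hasDerivWithinAt {f U : ℝ → ℝ} {a b : ℝ} (hab : a ≤ b)
    (h : ∀ x ∈ Icc a b, HasDerivWithinAt U (f x) (Icc a b) x) :
    HasCompactLaplaceIntegral f a b (U b - U a) := by
  have hc : ContinuousOn U (Icc a b) := fun x hx => (h x hx).continuousWithinAt
  rw [hasCompactLaplaceIntegral_iff hab]
  refine ⟨fun ε hε => ⟨U, isLaplaceMajorant_of_hasDerivWithinAt hc h, by linarith⟩,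
    fun ε hε => ⟨fun x => -U x, isLaplaceMajorant_of_hasDerivWithinAt hc.neg
      fun x hx => (h x hx).neg, by linarith⟩⟩

theorem hasDerivWithinAt_integral_of_continuousOn {f : ℝ → ℝ} {a b x : ℝ}
    (hf : ContinuousOn f (Icc a b)) (hx : x ∈ Icc a b) :
    HasDerivWithinAt (fun x => ∫ t in a..x, f t) (f x) (Icc a b) x := by
  have : intervalIntegral.FTCFilter x (𝓝[Icc a b] x) (𝓝[Icc a b] x) :=
    haveI : Fact (x ∈ Icc a b) := ⟨hx⟩
    inferInstance
  refine intervalIntegral.integral_hasDerivWithinAt_right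
    ((hf.mono (Icc_subset_Icc_right hx.2)).intervalIntegrable_of_Icc hx.1) ?_ (hf x hx)
  exact hf.stronglyMeasurableAtFilter_nhdsWithin measurableSet_Icc x

/-- The Laplace integral of a continuous function is its ordinary integral. -/
theorem hasCompactLaplaceIntegral_of_continuousOn {f : ℝ → ℝ} {a b : ℝ} (hab : a ≤ b)
    (hf : ContinuousOn f (Icc a b)) : HasCompactLaplaceIntegral f a b (∫ t in a..b, f t) := by
  simpa using hasCompactLaplaceIntegral_of_hasDerivWithinAt hab
    fun x hx => hasDerivWithinAt_integral_of_continuousOn hf hx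

/-! ### Integration by parts and uniqueness of the Laplace derivative. -/

theorem HasCompactLaplaceIntegral.le_majorant {f U : ℝ → ℝ} {a b J : ℝ}
    (h : HasCompactLaplaceIntegral f a b J) (hU : IsLaplaceMajorant f a b U) : J ≤ U b - U a :=
  h.1.1 ⟨fun x => U x + -U a, isLaplaceMajor_iff.2 ⟨hU.add_const _, by ring⟩, by ring⟩

/-- Continuity of `U` suffices because the other factor vanishes at `x`. -/
theorem hasDerivWithinAt_sub_mul {φ U : ℝ → ℝ} {m x : ℝ} {s : Set ℝ}
    (hφ : HasDerivWithinAt φ m s x) (hU : ContinuousWithinAt U s x) :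
    HasDerivWithinAt (fun y => (φ y - φ x) * U y) (m * U x) s x := by
  have h1 : HasDerivWithinAt (fun y => (φ y - φ x) * U x) (m * U x) s x :=
    (hφ.sub_const _).mul_const _
  have h2 : HasDerivWithinAt (fun y => (φ y - φ x) * (U y - U x)) 0 s x := by
    rw [hasDerivWithinAt_iff_isLittleO]
    have hU' : (fun y => U y - U x) =o[𝓝[s] x] fun _ => (1 : ℝ) := by
      rw [Asymptotics.isLittleO_one_iff]
      simpa using hU.sub_const (U x)
    simpa using hφ.differentiableWithinAt.isBigO_sub.mul_isLittleO hU'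
  refine ((h1.add h2).congr_deriv (add_zero _)).congr (fun y _ => ?_) (by simp)
  simp only [Pi.add_apply]
  ring

/-- Integration by parts for majorants. -/
theorem IsLaplaceMajorant.mul_sub_integral {f U φ φ' : ℝ → ℝ} {a b : ℝ}
    (hU : IsLaplaceMajorant f a b U) (hφ : ∀ x, HasDerivAt φ (φ' x) x) (hφ' : Continuous φ')
    (hpos : ∀ x, 0 < φ x) :
    IsLaplaceMajorant (fun x => φ x * f x) a b (fun x => φ x * U x - ∫ t in a..x, φ' t * U t) := by
  have hφc : Continuous φ := continuous_iff_continuousAt.2 fun x => (hφ x).continuousAt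
  have hint : ContinuousOn (fun t => φ' t * U t) (Icc a b) := hφ'.continuousOn.mul hU.cont
  have hprim : ContinuousOn (fun x => ∫ t in a..x, φ' t * U t) (Icc a b) := fun x hx =>
    (hasDerivWithinAt_integral_of_continuousOn hint hx).continuousWithinAt
  -- Around `x` the candidate is `φ x * U` plus a remainder with derivative zero at `x`; so its
  -- lower derivates are at least `φ x` times those guaranteed for `U`.
  have hA : ∀ x ∈ Icc a b, HasDerivWithinAt
      (fun y => (φ y - φ x) * U y - ∫ t in a..y, φ' t * U t) 0 (Icc a b) x := fun x hx =>
    ((hasDerivWithinAt_sub_mul (hφ x).hasDerivWithinAt (hU.cont x hx)).sub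
      (hasDerivWithinAt_integral_of_continuousOn hint hx)).congr_deriv (sub_self _)
  have hAc : ∀ x, ContinuousOn
      (fun y => (φ y - φ x) * U y - ∫ t in a..y, φ' t * U t) (Icc a b) := fun x =>
    ((hφc.continuousOn.sub continuousOn_const).mul hU.cont).sub hprim
  refine ⟨(hφc.continuousOn.mul hU.cont).sub hprim, fun x hx => ?_, fun x hx => ?_⟩
  · have := ((hU.right x hx).const_mul (hpos x)).add (laplaceLower_right_of_hasDerivWithinAt
      (hAc x) hx (hA x (Ico_subset_Icc_self hx)))
    rw [add_zero] at this
    exact this.congr one_pos fun t _ => by ring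
  · have := ((hU.left x hx).const_mul (hpos x)).add (laplaceLower_left_of_hasDerivWithinAt
      (hAc x) hx (hA x (Ioc_subset_Icc_self hx)))
    rw [add_zero] at this
    exact this.congr one_pos fun t _ => by ring

/-- The tail of the Laplace transform decays, estimated from above through a majorant. -/
theorem exists_sq_mul_integral_le {q U : ℝ → ℝ} {c d s₀ : ℝ} (hc : 0 < c) (hcd : c ≤ d)
    (hs₀ : 0 ≤ s₀) (hU : IsLaplaceMajorant (fun t => Real.exp (-s₀ * t) * q t) c d U) :
    ∃ B : ℝ → ℝ, Tendsto B atTop (𝓝 0) ∧ ∀ s ≥ s₀, ∀ J,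
      HasCompactLaplaceIntegral (fun t => Real.exp (-s * t) * q t) c d J → s ^ 2 * J ≤ B s := by
  obtain ⟨M, hM⟩ := isCompact_Icc.exists_bound_of_continuousOn hU.cont
  have hM0 : 0 ≤ M := (norm_nonneg _).trans (hM c ⟨le_rfl, hcd⟩)
  -- The `2` counts the boundary terms; the term with `s ^ 3` bounds the remaining integral, whose
  -- factor `s - s₀` is at most `s`.
  refine ⟨fun s => Real.exp (s₀ * c) * M * (2 * (s ^ 2 * Real.exp (-s * c)) +
    s ^ 3 * Real.exp (-s * c) * (d - c)), ?_, fun s hs J hJ => ?_⟩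
  · simpa using (((tendsto_pow_mul_exp_neg_mul 2 hc).const_mul 2).add
      ((tendsto_pow_mul_exp_neg_mul 3 hc).mul_const (d - c))).const_mul (Real.exp (s₀ * c) * M)
  set r := s - s₀ with hr
  have hr0 : 0 ≤ r := sub_nonneg.2 hs
  have hs0 : 0 ≤ s := hs₀.trans hs
  -- Parts with the factor `e^{-rt}` turns the majorant at exponent `s₀` into one at exponent `s`.
  have hW := hU.mul_sub_integral (φ := fun t => Real.exp (-r * t))
    (φ' := fun t => Real.exp (-r * t) * (-r * 1))
    (fun x => ((hasDerivAt_id x).const_mul (-r)).exp) (by fun_prop) (fun x => Real.exp_pos _)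
  have hfun : (fun t => Real.exp (-r * t) * (Real.exp (-s₀ * t) * q t))
      = fun t => Real.exp (-s * t) * q t := by
    ext t
    rw [← mul_assoc, ← Real.exp_add]
    congr 2
    ring
  rw [hfun] at hW
  have hJW := hJ.le_majorant hW
  simp only [intervalIntegral.integral_same, sub_zero] at hJW
  set e := Real.exp (-r * c) with he
  have he0 : 0 < e := Real.exp_pos _
  have hle : ∀ t, c ≤ t → Real.exp (-r * t) ≤ e := fun t ht =>
    Real.exp_le_exp.2 (by nlinarith)
  have hb : ∀ t, c ≤ t → t ≤ d → |Real.exp (-r * t) * U t| ≤ e * M := fun t ht htd => by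
    rw [abs_mul, abs_of_pos (Real.exp_pos _)]
    exact mul_le_mul (hle t ht) (hM t ⟨ht, htd⟩) (abs_nonneg _) he0.le
  have h1 := (abs_le.1 (hb d hcd le_rfl)).2
  have h2 := (abs_le.1 (hb c le_rfl hcd)).1
  have h3 : ‖∫ t in c..d, Real.exp (-r * t) * (-r * 1) * U t‖ ≤ (e * M * s) * |d - c| := by
    refine intervalIntegral.norm_integral_le_of_norm_le_const fun t ht => ?_
    rw [uIoc_of_le hcd] at ht
    have : Real.exp (-r * t) * (-r * 1) * U t = -(r * (Real.exp (-r * t) * U t)) := by ring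
    rw [this, norm_neg, norm_mul, Real.norm_of_nonneg hr0, mul_comm]
    exact mul_le_mul (hb t ht.1.le ht.2) (by linarith) hr0 (by positivity)
  rw [abs_of_nonneg (sub_nonneg.2 hcd), Real.norm_eq_abs] at h3
  have h4 := (abs_le.1 h3).1
  have hJe : J ≤ e * M * (2 + s * (d - c)) := by linarith
  have hee : e = Real.exp (s₀ * c) * Real.exp (-s * c) := by
    rw [he, ← Real.exp_add]
    congr 1
    rw [hr]
    ring
  calc s ^ 2 * J ≤ s ^ 2 * (e * M * (2 + s * (d - c))) := by gcongr
    _ = _ := by rw [hee]; ring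

theorem tendsto_sq_mul_sub_of_le {q R₁ R₂ : ℝ → ℝ} {δ₁ δ₂ : ℝ} (h0 : 0 < δ₁) (h12 : δ₁ ≤ δ₂)
    (h1 : ∀ᶠ s in atTop, HasCompactLaplaceIntegral (fun t => Real.exp (-s * t) * q t) 0 δ₁ (R₁ s))
    (h2 : ∀ᶠ s in atTop, HasCompactLaplaceIntegral (fun t => Real.exp (-s * t) * q t) 0 δ₂ (R₂ s)) :
    Tendsto (fun s => s ^ 2 * (R₂ s - R₁ s)) atTop (𝓝 0) := by
  have h3 : ∀ᶠ s in atTop,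
      HasCompactLaplaceIntegral (fun t => Real.exp (-s * t) * q t) δ₁ δ₂ (R₂ s - R₁ s) := by
    filter_upwards [h1, h2] with s hs1 hs2
    obtain ⟨K, hK⟩ := hs2.restrict h0.le h12 le_rfl
    rw [hs2.unique (hs1.concat hK h0.le h12)]
    simpa using hK
  -- Majorants at this single exponent control the tail for all larger `s`; using both `q` and `-q`
  -- gives two-sided bounds.
  obtain ⟨s₀, hs₀, hs₀'⟩ := (h3.and (eventually_ge_atTop 0)).exists
  obtain ⟨hu, hl⟩ := (hasCompactLaplaceIntegral_iff h12).1 hs₀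
  obtain ⟨U, hU, -⟩ := hu 1 one_pos
  obtain ⟨W, hW, -⟩ := hl 1 one_pos
  simp only [← mul_neg] at hW
  obtain ⟨B, hB, hB'⟩ := exists_sq_mul_integral_le h0 h12 hs₀' hU
  obtain ⟨C, hC, hC'⟩ := exists_sq_mul_integral_le (q := fun t => -q t) h0 h12 hs₀' hW
  have hCn := hC.neg
  rw [neg_zero] at hCn
  refine tendsto_of_tendsto_of_tendsto_of_le_of_le' hCn hB ?_ ?_
  · filter_upwards [h3, eventually_ge_atTop s₀] with s hs hs'
    have hn := hs.neg h12
    simp only [← mul_neg] at hn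
    have := hC' s hs' _ hn
    linarith
  · filter_upwards [h3, eventually_ge_atTop s₀] with s hs hs'
    exact hB' s hs' _ hs

/-- The right-hand limits suffice: changing the radius alters them only by a vanishing tail. -/
theorem HasLaplaceDeriv.unique {f : ℝ → ℝ} {x L L' : ℝ} (h : HasLaplaceDeriv f x L)
    (h' : HasLaplaceDeriv f x L') : L = L' := by
  obtain ⟨δ, hδ, -, ⟨R, hR, hRL⟩, -⟩ := h
  obtain ⟨δ', hδ', -, ⟨R', hR', hRL'⟩, -⟩ := h'
  rcases le_total δ δ' with hle | hle
  · have := tendsto_sq_mul_sub_of_le hδ hle hR hR'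
    simp only [mul_sub] at this
    linarith [tendsto_nhds_unique this (hRL'.sub hRL)]
  · have := tendsto_sq_mul_sub_of_le hδ' hle hR' hR
    simp only [mul_sub] at this
    linarith [tendsto_nhds_unique this (hRL.sub hRL')]

theorem tendsto_laplaceQuot {k : ℝ → ℝ} {m δ : ℝ} (h1 : LaplaceLower k m)
    (h2 : LaplaceLower (fun t => -k t) (-m)) (hδ : 0 < δ) (hk : ContinuousOn k (Icc 0 δ)) :
    Tendsto (laplaceQuot k δ) atTop (𝓝 m) := by
  refine tendsto_order.2 ⟨fun m' hm' => h1.eventually hδ hk m' hm', fun m' hm' => ?_⟩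
  filter_upwards [h2.eventually hδ hk.neg (-m') (by linarith)] with s hs
  rw [laplaceQuot_neg] at hs
  linarith

/-! ### The fundamental theorem: indefinite Laplace integrals. -/

section Primitive

variable {h Φ : ℝ → ℝ} {p q : ℝ}

/-- Monotonicity holds because on every subinterval a majorant increases at least as much as the
integral. -/
theorem exists_majorant_seq (hpq : p ≤ q)
    (H : ∀ c d, p ≤ c → c ≤ d → d ≤ q → HasCompactLaplaceIntegral h c d (Φ d - Φ c)) {ε : ℝ}
    (hε : 0 < ε) : ∃ U, IsLaplaceMajorant h p q U ∧ MonotoneOn (fun x => U x - Φ x) (Icc p q) ∧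
      (U q - Φ q) - (U p - Φ p) < ε := by
  obtain ⟨U, hU, hlt⟩ :=
    ((hasCompactLaplaceIntegral_iff hpq).1 (H p q le_rfl hpq le_rfl)).1 ε hε
  refine ⟨U, hU, fun c hc d hd hcd => ?_, by linarith⟩
  have := (H c d hc.1 hcd hd.2).le_majorant (hU.restrict hc.1 hd.2)
  simp only
  linarith

/-- The monotone difference `U - Φ` varies by less than `ε`, so `Φ` is a uniform limit of shifted
majorants. -/
theorem continuousOn_of_hasCompactLaplaceIntegral (hpq : p ≤ q)
    (H : ∀ c d, p ≤ c → c ≤ d → d ≤ q → HasCompactLaplaceIntegral h c d (Φ d - Φ c)) :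
    ContinuousOn Φ (Icc p q) := by
  refine continuousOn_of_uniform_approx_of_continuousOn fun u hu => ?_
  obtain ⟨ε, hε, hεu⟩ := Metric.mem_uniformity_dist.1 hu
  obtain ⟨U, hU, hm, hlt⟩ := exists_majorant_seq hpq H hε
  refine ⟨fun x => U x - (U p - Φ p), hU.cont.sub continuousOn_const, fun y hy => hεu ?_⟩
  have h1 := hm ⟨le_rfl, hpq⟩ hy hy.1
  have h2 := hm hy ⟨hpq, le_rfl⟩ hy.2
  simp only at h1 h2
  rw [Real.dist_eq, abs_lt]
  constructor <;> linarith

/-- The derivative of a monotone function integrates to at most its increase, so these integrals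
tend to `0`; Fatou then gives liminf zero a.e. -/
theorem ae_exists_deriv_lt {w : ℕ → ℝ → ℝ} (hpq : p ≤ q) (hm : ∀ n, MonotoneOn (w n) (Icc p q))
    (hw : ∀ n, w n q - w n p < 1 / ((n : ℝ) + 1)) :
    ∀ᵐ x : ℝ, x ∈ Ioo p q → ∀ η > 0, ∃ n, ∃ D < η, HasDerivAt (w n) D x := by
  have hdiff : ∀ᵐ x : ℝ, ∀ n, x ∈ Icc p q → DifferentiableWithinAt ℝ (w n) (Icc p q) x :=
    ae_all_iff.2 fun n => (hm n).ae_differentiableWithinAt_of_mem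
  have hnn : ∀ n, ∀ x ∈ Ioo p q, 0 ≤ deriv (w n) x := fun n x hx => by
    rw [← derivWithin_of_mem_nhds (Icc_mem_nhds hx.1 hx.2)]
    exact (hm n).derivWithin_nonneg
  have hint : ∀ n, IntegrableOn (deriv (w n)) (Ioo p q) := fun n => by
    have : IntervalIntegrable (deriv (w n)) volume p q :=
      MonotoneOn.intervalIntegrable_deriv (by rw [uIcc_of_le hpq]; exact hm n)
    exact ((intervalIntegrable_iff_integrableOn_Ioc_of_le hpq).1 this).mono_set Ioo_subset_Ioc_self
  have hbound : ∀ n, ∫⁻ x in Ioo p q, ENNReal.ofReal (deriv (w n) x)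
      ≤ ENNReal.ofReal (1 / ((n : ℝ) + 1)) := fun n => by
    rw [← ofReal_integral_eq_lintegral_ofReal (hint n)
      ((ae_restrict_iff' measurableSet_Ioo).2 (ae_of_all _ (hnn n)))]
    apply ENNReal.ofReal_le_ofReal
    have h1 := MonotoneOn.intervalIntegral_deriv_mem_uIcc (f := w n) (a := p) (b := q)
      (by rw [uIcc_of_le hpq]; exact hm n)
    have h2 := hm n ⟨le_rfl, hpq⟩ ⟨hpq, le_rfl⟩ hpq
    rw [uIcc_of_le (sub_nonneg.2 h2), intervalIntegral.integral_of_le hpq,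
      integral_Ioc_eq_integral_Ioo] at h1
    exact h1.2.trans (hw n).le
  have hlim : liminf (fun n => ∫⁻ x in Ioo p q, ENNReal.ofReal (deriv (w n) x)) atTop = 0 := by
    apply Tendsto.liminf_eq
    refine tendsto_of_tendsto_of_tendsto_of_le_of_le tendsto_const_nhds ?_ (fun _ => zero_le)
      hbound
    simpa using ENNReal.tendsto_ofReal tendsto_one_div_add_atTop_nhds_zero_nat
  have hmeas : ∀ n, Measurable fun x => ENNReal.ofReal (deriv (w n) x) := fun n =>
    (measurable_deriv _).ennreal_ofReal
  have hfatou := lintegral_liminf_le (u := atTop) (μ := volume.restrict (Ioo p q)) hmeas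
  rw [hlim, nonpos_iff_eq_zero, lintegral_eq_zero_iff (Measurable.liminf hmeas)] at hfatou
  have hae := (ae_restrict_iff' measurableSet_Ioo).1 hfatou
  filter_upwards [hae, hdiff] with x hx hd hxm η hη
  have hx0 := hx hxm
  simp only [Pi.zero_apply] at hx0
  obtain ⟨n, hn⟩ := (frequently_lt_of_liminf_lt (b := ENNReal.ofReal η) (by isBoundedDefault)
    (by rw [hx0]; simpa using hη)).exists
  refine ⟨n, deriv (w n) x, (ENNReal.ofReal_lt_ofReal_iff hη).1 hn, ?_⟩
  exact ((hd n (Ioo_subset_Icc_self hxm)).differentiableAt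
    (Icc_mem_nhds hxm.1 hxm.2)).hasDerivAt

/-- Write `Φ` as `U n - (U n - Φ)`: subtracting a function with derivative `D` lowers the derivate
bound by `D`, which can be taken arbitrarily small. -/
theorem ae_laplaceLower (hpq : p ≤ q)
    (H : ∀ c d, p ≤ c → c ≤ d → d ≤ q → HasCompactLaplaceIntegral h c d (Φ d - Φ c)) :
    ∀ᵐ x : ℝ, x ∈ Ioo p q → LaplaceLower (fun t => Φ (x + t) - Φ x) (h x) ∧
      LaplaceLower (fun t => Φ x - Φ (x - t)) (h x) := by
  have hΦ := continuousOn_of_hasCompactLaplaceIntegral hpq H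
  choose U hU hm hlt using fun n : ℕ =>
    exists_majorant_seq hpq H (show 0 < 1 / ((n : ℝ) + 1) by positivity)
  filter_upwards [ae_exists_deriv_lt hpq hm hlt] with x hx hxm
  constructor
  · refine LaplaceLower.of_forall_lt fun m hm' => ?_
    obtain ⟨n, D, hD, hder⟩ := hx hxm (h x - m) (by linarith)
    have h1 := (hU n).right x ⟨hxm.1.le, hxm.2⟩
    have h2 := laplaceLower_right_of_hasDerivWithinAt ((hU n).cont.sub hΦ).neg
      ⟨hxm.1.le, hxm.2⟩ hder.neg.hasDerivWithinAt
    refine (h1.add h2).mono (by linarith) (sub_pos.2 hxm.2)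
      (continuousOn_rightIncrement hΦ hxm.1.le le_rfl) fun t _ => ?_
    simp only [Pi.neg_apply, Pi.sub_apply]
    linarith
  · refine LaplaceLower.of_forall_lt fun m hm' => ?_
    obtain ⟨n, D, hD, hder⟩ := hx hxm (h x - m) (by linarith)
    have h1 := (hU n).left x ⟨hxm.1, hxm.2.le⟩
    have h2 := laplaceLower_left_of_hasDerivWithinAt ((hU n).cont.sub hΦ).neg
      ⟨hxm.1, hxm.2.le⟩ hder.neg.hasDerivWithinAt
    refine (h1.add h2).mono (by linarith) (sub_pos.2 hxm.1)
      (continuousOn_leftIncrement hΦ hxm.2.le le_rfl) fun t _ => ?_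
    simp only [Pi.neg_apply, Pi.sub_apply]
    linarith

/-- The Laplace derivative of an indefinite Laplace integral is almost everywhere the integrand. -/
theorem ae_hasLaplaceDeriv (hpq : p ≤ q)
    (H : ∀ c d, p ≤ c → c ≤ d → d ≤ q → HasCompactLaplaceIntegral h c d (Φ d - Φ c)) :
    ∀ᵐ x : ℝ, x ∈ Ioo p q → HasLaplaceDeriv Φ x (h x) := by
  have hΦ := continuousOn_of_hasCompactLaplaceIntegral hpq H
  -- Lower derivates of `-Φ` yield the upper ones of `Φ`.
  have Hn : ∀ c d, p ≤ c → c ≤ d → d ≤ q →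
      HasCompactLaplaceIntegral (fun x => -h x) c d (-Φ d - -Φ c) := fun c d h1 h2 h3 => by
    have := (H c d h1 h2 h3).neg h2
    rwa [show -(Φ d - Φ c) = -Φ d - -Φ c by ring] at this
  filter_upwards [ae_laplaceLower hpq H, ae_laplaceLower hpq Hn] with x hx hxn hxm
  set δ := min (x - p) (q - x) with hδ
  have hδ0 : 0 < δ := lt_min (sub_pos.2 hxm.1) (sub_pos.2 hxm.2)
  have hδ1 : δ ≤ x - p := min_le_left _ _
  have hδ2 : δ ≤ q - x := min_le_right _ _
  have hcr := continuousOn_rightIncrement hΦ hxm.1.le hδ2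
  have hcl := continuousOn_leftIncrement hΦ hxm.2.le hδ1
  have hcl' : ContinuousOn (fun t => Φ (x - t) - Φ x) (Icc 0 δ) :=
    hcl.neg.congr fun t _ => by simp
  refine ⟨δ, hδ0, ⟨_, hasCompactLaplaceIntegral_of_continuousOn (by linarith)
    (hΦ.mono (Icc_subset_Icc (by linarith) (by linarith)))⟩,
    ⟨fun s => ∫ t in (0 : ℝ)..δ, Real.exp (-s * t) * (Φ (x + t) - Φ x),
      Eventually.of_forall fun s => hasCompactLaplaceIntegral_of_continuousOn hδ0.le
        ((Continuous.continuousOn (by fun_prop)).mul hcr), ?_⟩,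
    ⟨fun s => ∫ t in (0 : ℝ)..δ, Real.exp (-s * t) * (Φ (x - t) - Φ x),
      Eventually.of_forall fun s => hasCompactLaplaceIntegral_of_continuousOn hδ0.le
        ((Continuous.continuousOn (by fun_prop)).mul hcl'), ?_⟩⟩
  · exact tendsto_laplaceQuot (hx hxm).1
      ((hxn hxm).1.congr one_pos fun t _ => by ring) hδ0 hcr
  · refine (tendsto_laplaceQuot (hx hxm).2
      ((hxn hxm).2.congr one_pos fun t _ => by ring) hδ0 hcl).congr fun s => ?_
    rw [← laplaceQuotLeft_eq]
    rfl

end Primitive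

/-! ### Primitives on intervals of extended reals. -/

/-- `Φ` is an indefinite Laplace integral of `g` on the interval `[s, t]` of extended reals. -/
structure IsLaplacePrimitive (g : ℝ → ℝ) (s t : EReal) (Φ : EReal → ℝ) : Prop where
  cont : ContinuousOn Φ (Icc s t)
  integral : ∀ c d : ℝ, s ≤ c → c ≤ d → (d : EReal) ≤ t →
    HasCompactLaplaceIntegral g c d (Φ d - Φ c)

theorem hasCompactLaplaceIntegral_refl (g : ℝ → ℝ) (c : ℝ) : HasCompactLaplaceIntegral g c c 0 := by
  have : ∀ h : ℝ → ℝ, LaplaceUpperLE h c c 0 := fun h ε hε =>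
    ⟨fun _ => 0, ⟨continuousOn_const, by simp, by simp⟩, by simpa using hε⟩
  rw [hasCompactLaplaceIntegral_iff le_rfl, neg_zero]
  exact ⟨this _, this _⟩

theorem exists_real_primitive {g : ℝ → ℝ} {S : Set ℝ}
    (H : ∀ c ∈ S, ∀ d ∈ S, c ≤ d → ∃ J, HasCompactLaplaceIntegral g c d J) :
    ∃ P : ℝ → ℝ, ∀ c ∈ S, ∀ d ∈ S, c ≤ d → HasCompactLaplaceIntegral g c d (P d - P c) := by
  classical
  rcases S.eq_empty_or_nonempty with rfl | ⟨o, ho⟩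
  · exact ⟨0, by simp⟩
  have : ∀ c d, ∃ J, c ∈ S → d ∈ S → c ≤ d → HasCompactLaplaceIntegral g c d J := fun c d => by
    by_cases h : c ∈ S ∧ d ∈ S ∧ c ≤ d
    · obtain ⟨J, hJ⟩ := H c h.1 d h.2.1 h.2.2
      exact ⟨J, fun _ _ _ => hJ⟩
    · exact ⟨0, fun h1 h2 h3 => absurd ⟨h1, h2, h3⟩ h⟩
  choose I hI using this
  -- The oriented integral from the base point `o`.
  refine ⟨fun x => if o ≤ x then I o x else -I x o, fun c hc d hd hcd => ?_⟩
  have hK := hI c d hc hd hcd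
  rcases le_or_gt o c with h1 | h1
  · have := (hI o d ho hd (h1.trans hcd)).unique ((hI o c ho hc h1).concat hK h1 hcd)
    simp only [h1, h1.trans hcd, if_true, this]
    simpa using hK
  rcases le_or_gt o d with h2 | h2
  · simp only [h1.not_ge, h2, if_true, if_false]
    convert (hI c o hc ho h1.le).concat (hI o d ho hd h2) h1.le h2 using 1
    ring
  · have := (hI c o hc ho h1.le).unique (hK.concat (hI d o hd ho h2.le) hcd h2.le)
    simp only [h1.not_ge, h2.not_ge, if_false, this]
    simpa using hK

/-- Continuity at an infinite end point is convergence of the improper integral. At real points it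
is local, hence follows from the compact case. An unneeded `u` or `l` is a filler value. -/
theorem exists_isLaplacePrimitive {g P : ℝ → ℝ} {s t : EReal} {u l : ℝ}
    (H : ∀ c d : ℝ, s ≤ c → c ≤ d → (d : EReal) ≤ t → HasCompactLaplaceIntegral g c d (P d - P c))
    (htop : t = ⊤ → Tendsto P atTop (𝓝 u)) (hbot : s = ⊥ → Tendsto P atBot (𝓝 l)) :
    ∃ Φ, IsLaplacePrimitive g s t Φ ∧ (∀ x : ℝ, Φ x = P x) ∧ Φ ⊤ = u ∧ Φ ⊥ = l := by
  classical
  set Φ : EReal → ℝ := fun x => if x = ⊤ then u else if x = ⊥ then l else P x.toReal with hΦ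
  have hreal : ∀ x : ℝ, Φ x = P x := fun x => by simp [hΦ]
  have hu : Φ ⊤ = u := by simp [hΦ]
  have hl : Φ ⊥ = l := by simp [hΦ]
  refine ⟨Φ, ⟨fun x hx => ?_, fun c d h1 h2 h3 => by rw [hreal, hreal]; exact H c d h1 h2 h3⟩,
    hreal, hu, hl⟩
  induction x with
  | bot =>
    have hs : s = ⊥ := le_bot_iff.1 hx.1
    refine ContinuousAt.continuousWithinAt ?_
    rw [ContinuousAt, hl, Metric.tendsto_nhds]
    intro ε hε
    obtain ⟨M, hM⟩ := eventually_atBot.1 (Metric.tendsto_nhds.1 (hbot hs) ε hε)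
    filter_upwards [Iio_mem_nhds (EReal.bot_lt_coe M)] with y hy
    induction y with
    | bot => simpa [hl] using hε
    | coe y => rw [hreal]; exact hM y (EReal.coe_lt_coe_iff.1 hy).le
    | top => exact absurd hy (by simp)
  | top =>
    have ht : t = ⊤ := top_le_iff.1 hx.2
    refine ContinuousAt.continuousWithinAt ?_
    rw [ContinuousAt, hu, Metric.tendsto_nhds]
    intro ε hε
    obtain ⟨M, hM⟩ := eventually_atTop.1 (Metric.tendsto_nhds.1 (htop ht) ε hε)
    filter_upwards [Ioi_mem_nhds (EReal.coe_lt_top M)] with y hy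
    induction y with
    | bot => exact absurd hy (by simp)
    | coe y => rw [hreal]; exact hM y (EReal.coe_lt_coe_iff.1 hy).le
    | top => simpa [hu] using hε
  | coe x =>
    rw [ContinuousWithinAt, ← EReal.isOpenEmbedding_coe.map_nhdsWithin_preimage_eq, tendsto_map'_iff]
    have hcomp : Φ ∘ ((↑) : ℝ → EReal) = P := funext hreal
    rw [hcomp, hreal]
    -- If no real point of the interval lies to the left of `x`, then `x` itself serves as `c`;
    -- likewise for `d` on the right.
    obtain ⟨c, hcx, hc, hcn⟩ : ∃ c : ℝ, c ≤ x ∧ s ≤ c ∧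
        Ici c ∈ 𝓝[((↑) : ℝ → EReal) ⁻¹' Icc s t] x := by
      by_cases h : ∃ c : ℝ, c < x ∧ s ≤ c
      · obtain ⟨c, h1, h2⟩ := h
        exact ⟨c, h1.le, h2, mem_nhdsWithin_of_mem_nhds (Ici_mem_nhds h1)⟩
      · push Not at h
        refine ⟨x, le_rfl, hx.1, mem_of_superset self_mem_nhdsWithin fun y hy => ?_⟩
        by_contra hyx
        exact (h y (not_le.1 hyx)).not_ge hy.1
    obtain ⟨d, hxd, hd, hdn⟩ : ∃ d : ℝ, x ≤ d ∧ d ≤ t ∧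
        Iic d ∈ 𝓝[((↑) : ℝ → EReal) ⁻¹' Icc s t] x := by
      by_cases h : ∃ d : ℝ, x < d ∧ d ≤ t
      · obtain ⟨d, h1, h2⟩ := h
        exact ⟨d, h1.le, h2, mem_nhdsWithin_of_mem_nhds (Iic_mem_nhds h1)⟩
      · push Not at h
        refine ⟨x, le_rfl, hx.2, mem_of_superset self_mem_nhdsWithin fun y hy => ?_⟩
        by_contra hyx
        exact (h y (not_le.1 hyx)).not_ge hy.2
    have hcont := continuousOn_of_hasCompactLaplaceIntegral (hcx.trans hxd) (h := g) (Φ := P)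
      fun c' d' h1 h2 h3 => H c' d' (hc.trans (EReal.coe_le_coe_iff.2 h1)) h2
        ((EReal.coe_le_coe_iff.2 h3).trans hd)
    exact (hcont x ⟨hcx, hxd⟩).mono_of_mem_nhdsWithin (inter_mem hcn hdn)

theorem HasLaplaceIntegralIcc.exists_primitive {g : ℝ → ℝ} {s t : EReal} {J : ℝ}
    (h : HasLaplaceIntegralIcc g s t J) (hst : s ≤ t) :
    ∃ Φ, IsLaplacePrimitive g s t Φ ∧ J = Φ t - Φ s := by
  rcases h with ⟨rfl, rfl⟩ | ⟨a, b, rfl, rfl, h⟩ | ⟨a, rfl, rfl, Ψ, h, hlim⟩ |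
    ⟨b, rfl, rfl, Ψ, h, hlim⟩ | ⟨rfl, rfl, m, J₁, J₂, ⟨Ψ₁, h1, hl1⟩, ⟨Ψ₂, h2, hl2⟩, rfl⟩
  · refine ⟨fun _ => 0, ⟨continuousOn_const, fun c d h1 h2 h3 => ?_⟩, by simp⟩
    have : c = d := le_antisymm h2 (EReal.coe_le_coe_iff.1 (h3.trans h1))
    subst this
    simpa using hasCompactLaplaceIntegral_refl g c
  · obtain ⟨P, hP⟩ := exists_real_primitive (S := Icc a b) (g := g) fun c hc d hd hcd =>
      h.restrict hc.1 hcd hd.2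
    obtain ⟨Φ, hΦ, hr, -, -⟩ := exists_isLaplacePrimitive (s := a) (t := b) (u := 0) (l := 0)
      (fun c d h1 h2 h3 => hP c ⟨EReal.coe_le_coe_iff.1 h1, h2.trans (EReal.coe_le_coe_iff.1 h3)⟩ d
        ⟨(EReal.coe_le_coe_iff.1 h1).trans h2, EReal.coe_le_coe_iff.1 h3⟩ h2) (by simp) (by simp)
    exact ⟨Φ, hΦ, h.unique (hΦ.integral a b le_rfl (EReal.coe_le_coe_iff.1 hst) le_rfl)⟩
  · obtain ⟨P, hP⟩ := exists_real_primitive (S := Ici a) (g := g) fun c hc d hd hcd =>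
      (h d hd).restrict hc hcd le_rfl
    have hPt : Tendsto P atTop (𝓝 (J + P a)) := (hlim.add_const (P a)).congr' <| by
      filter_upwards [eventually_ge_atTop a] with c hc
      rw [(h c hc).unique (hP a self_mem_Ici c hc hc)]
      ring
    obtain ⟨Φ, hΦ, hr, hu, -⟩ := exists_isLaplacePrimitive (s := a) (t := ⊤) (l := 0)
      (fun c d h1 h2 h3 => hP c (EReal.coe_le_coe_iff.1 h1) d
        ((EReal.coe_le_coe_iff.1 h1).trans h2) h2) (fun _ => hPt) (by simp)
    exact ⟨Φ, hΦ, by rw [hu, hr]; ring⟩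
  · obtain ⟨P, hP⟩ := exists_real_primitive (S := Iic b) (g := g) fun c hc d hd hcd =>
      (h c hc).restrict le_rfl hcd hd
    have hPt : Tendsto P atBot (𝓝 (P b - J)) := (hlim.const_sub (P b)).congr' <| by
      filter_upwards [eventually_le_atBot b] with c hc
      rw [(h c hc).unique (hP c hc b self_mem_Iic hc)]
      ring
    obtain ⟨Φ, hΦ, hr, -, hl⟩ := exists_isLaplacePrimitive (s := ⊥) (t := b) (u := 0)
      (fun c d h1 h2 h3 => hP c (h2.trans (EReal.coe_le_coe_iff.1 h3)) d
        (EReal.coe_le_coe_iff.1 h3) h2) (by simp) (fun _ => hPt)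
    exact ⟨Φ, hΦ, by rw [hl, hr]; ring⟩
  · obtain ⟨P, hP⟩ := exists_real_primitive (S := univ) (g := g) fun c _ d _ hcd =>
      -- A compact interval containing `c`, `d` and the splitting point `m`.
      ((h1 (min c m) (min_le_right _ _)).concat (h2 (max d m) (le_max_right _ _))
        (min_le_right _ _) (le_max_right _ _)).restrict (min_le_left _ _) hcd (le_max_left _ _)
    have hPt : Tendsto P atTop (𝓝 (J₂ + P m)) := (hl2.add_const (P m)).congr' <| by
      filter_upwards [eventually_ge_atTop m] with c hc
      rw [(h2 c hc).unique (hP m trivial c trivial hc)]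
      ring
    have hPb : Tendsto P atBot (𝓝 (P m - J₁)) := (hl1.const_sub (P m)).congr' <| by
      filter_upwards [eventually_le_atBot m] with c hc
      rw [(h1 c hc).unique (hP c trivial m trivial hc)]
      ring
    obtain ⟨Φ, hΦ, hr, hu, hl⟩ := exists_isLaplacePrimitive (s := ⊥) (t := ⊤)
      (fun c d _ h2 _ => hP c trivial d trivial h2) (fun _ => hPt) (fun _ => hPb)
    exact ⟨Φ, hΦ, by rw [hu, hl]; ring⟩

namespace IsLaplacePrimitive

variable {f g : ℝ → ℝ} {s t s' t' : EReal} {Φ Ψ : EReal → ℝ}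

theorem tendsto_top (h : IsLaplacePrimitive g s ⊤ Φ) (hs : s ≠ ⊤) :
    Tendsto (fun c : ℝ => Φ c) atTop (𝓝 (Φ ⊤)) := by
  refine (h.cont ⊤ ⟨le_top, le_rfl⟩).tendsto.comp (tendsto_nhdsWithin_iff.2 ⟨?_, ?_⟩)
  · exact EReal.tendsto_nhds_top_iff_real.2 fun M => (eventually_gt_atTop M).mono fun x hx =>
      EReal.coe_lt_coe_iff.2 hx
  · induction s with
    | top => exact absurd rfl hs
    | bot => exact Eventually.of_forall fun x => ⟨bot_le, le_top⟩
    | coe s => exact (eventually_ge_atTop s).mono fun x hx => ⟨EReal.coe_le_coe_iff.2 hx, le_top⟩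

theorem tendsto_bot (h : IsLaplacePrimitive g ⊥ t Φ) (ht : t ≠ ⊥) :
    Tendsto (fun c : ℝ => Φ c) atBot (𝓝 (Φ ⊥)) := by
  refine (h.cont ⊥ ⟨le_rfl, bot_le⟩).tendsto.comp (tendsto_nhdsWithin_iff.2 ⟨?_, ?_⟩)
  · exact EReal.tendsto_nhds_bot_iff_real.2 fun M => (eventually_lt_atBot M).mono fun x hx =>
      EReal.coe_lt_coe_iff.2 hx
  · induction t with
    | bot => exact absurd rfl ht
    | top => exact Eventually.of_forall fun x => ⟨bot_le, le_top⟩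
    | coe t => exact (eventually_le_atBot t).mono fun x hx => ⟨bot_le, EReal.coe_le_coe_iff.2 hx⟩

theorem restrict (h : IsLaplacePrimitive g s t Φ) (hs : s ≤ s') (ht : t' ≤ t) :
    IsLaplacePrimitive g s' t' Φ :=
  ⟨h.cont.mono (Icc_subset_Icc hs ht), fun c d h1 h2 h3 =>
    h.integral c d (hs.trans h1) h2 (h3.trans ht)⟩

theorem hasLaplaceIntegralIcc (h : IsLaplacePrimitive g s t Φ) (hst : s ≤ t) :
    HasLaplaceIntegralIcc g s t (Φ t - Φ s) := by
  rcases hst.eq_or_lt with rfl | hlt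
  · exact Or.inl ⟨rfl, sub_self _⟩
  right
  induction s with
  | top => exact absurd hlt (by simp)
  | coe a =>
    induction t with
    | bot => exact absurd hlt (by simp)
    | coe b => exact Or.inl ⟨a, b, rfl, rfl, h.integral a b le_rfl
        (EReal.coe_le_coe_iff.1 hst) le_rfl⟩
    | top => exact Or.inr (Or.inl ⟨a, rfl, rfl, fun c => Φ c - Φ a,
        fun c hc => h.integral a c le_rfl hc le_top, (h.tendsto_top (by simp)).sub_const _⟩)
  | bot =>
    induction t with
    | bot => exact absurd hlt (by simp)
    | coe b => exact Or.inr (Or.inr (Or.inl ⟨b, rfl, rfl, fun c => Φ b - Φ c,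
        fun c hc => h.integral c b bot_le hc le_rfl, (h.tendsto_bot (by simp)).const_sub _⟩))
    | top => exact Or.inr (Or.inr (Or.inr ⟨rfl, rfl, 0, Φ (0 : ℝ) - Φ ⊥, Φ ⊤ - Φ (0 : ℝ),
        ⟨fun c => Φ (0 : ℝ) - Φ c, fun c hc => h.integral c 0 bot_le hc le_top,
          (h.tendsto_bot (by simp)).const_sub _⟩,
        ⟨fun c => Φ c - Φ (0 : ℝ), fun c hc => h.integral 0 c bot_le hc le_top,
          (h.tendsto_top (by simp)).sub_const _⟩, by ring⟩))

/-- Compact uniqueness makes the difference constant at real interior points; continuity carries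
this to the end points. -/
theorem unique (hΦ : IsLaplacePrimitive g s t Φ) (hΨ : IsLaplacePrimitive g s t Ψ) (hst : s ≤ t) :
    Φ t - Φ s = Ψ t - Ψ s := by
  rcases hst.eq_or_lt with rfl | hlt
  · simp
  obtain ⟨o, ho1, ho2⟩ := EReal.lt_iff_exists_real_btwn.1 hlt
  have hE : EqOn (fun x => Φ x - Ψ x) (fun _ => Φ o - Ψ o) (Icc s t) := by
    refine EqOn.of_subset_closure (s := Ioo s t) (fun x hx => ?_) (hΦ.cont.sub hΨ.cont)
      continuousOn_const Ioo_subset_Icc_self (closure_Ioo hlt.ne).ge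
    induction x with
    | bot => exact absurd hx.1 (by simp)
    | top => exact absurd hx.2 (by simp)
    | coe x =>
      rcases le_total x o with hle | hle
      · linarith [(hΦ.integral x o hx.1.le hle ho2.le).unique (hΨ.integral x o hx.1.le hle ho2.le)]
      · linarith [(hΦ.integral o x ho1.le hle hx.2.le).unique (hΨ.integral o x ho1.le hle hx.2.le)]
  have h1 := hE ⟨hst, le_rfl⟩
  have h2 := hE ⟨le_rfl, hst⟩
  simp only at h1 h2
  linarith

theorem add (hf : IsLaplacePrimitive f s t Φ) (hg : IsLaplacePrimitive g s t Ψ) :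
    IsLaplacePrimitive (fun x => f x + g x) s t (fun x => Φ x + Ψ x) :=
  ⟨hf.cont.add hg.cont, fun c d h1 h2 h3 => by
    have := (hf.integral c d h1 h2 h3).add (hg.integral c d h1 h2 h3) h2
    rwa [sub_add_sub_comm] at this⟩

theorem neg (hf : IsLaplacePrimitive f s t Φ) :
    IsLaplacePrimitive (fun x => -f x) s t (fun x => -Φ x) :=
  ⟨hf.cont.neg, fun c d h1 h2 h3 => by
    have := (hf.integral c d h1 h2 h3).neg h2
    rwa [neg_sub, ← neg_sub_neg] at this⟩

theorem congr_ae (hf : IsLaplacePrimitive f s t Φ)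
    (h : ∀ᵐ x : ℝ, s < x → (x : EReal) < t → f x = g x) : IsLaplacePrimitive g s t Φ :=
  ⟨hf.cont, fun c d h1 h2 h3 => (hf.integral c d h1 h2 h3).congr_ae h2 <| h.mono fun _ hx hcx hxd =>
    hx (h1.trans_lt (EReal.coe_lt_coe_iff.2 hcx)) ((EReal.coe_lt_coe_iff.2 hxd).trans_le h3)⟩

end IsLaplacePrimitive

/-! ### Oriented integrals and functions defined almost everywhere. -/

/-- Removes the case distinction over finite and infinite end points, so linearity and a.e.
invariance reduce to those of primitives. -/
theorem hasLaplaceIntegral_iff {g : ℝ → ℝ} {s t : EReal} {J : ℝ} :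
    HasLaplaceIntegral g s t J ↔
      ∃ Φ, IsLaplacePrimitive g (min s t) (max s t) Φ ∧ J = Φ t - Φ s := by
  constructor
  · rintro (⟨hst, h⟩ | ⟨hst, h⟩)
    · obtain ⟨Φ, hΦ, rfl⟩ := h.exists_primitive hst
      exact ⟨Φ, by rwa [min_eq_left hst, max_eq_right hst], rfl⟩
    · obtain ⟨Φ, hΦ, hJ⟩ := h.exists_primitive hst
      exact ⟨Φ, by rwa [min_eq_right hst, max_eq_left hst], by linarith⟩
  · rintro ⟨Φ, hΦ, rfl⟩
    rcases le_total s t with hst | hst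
    · rw [min_eq_left hst, max_eq_right hst] at hΦ
      exact Or.inl ⟨hst, hΦ.hasLaplaceIntegralIcc hst⟩
    · rw [min_eq_right hst, max_eq_left hst] at hΦ
      refine Or.inr ⟨hst, ?_⟩
      rw [neg_sub]
      exact hΦ.hasLaplaceIntegralIcc hst

namespace HasLaplaceIntegral

variable {f g : ℝ → ℝ} {s t : EReal} {J K : ℝ}

theorem congr_ae (h : HasLaplaceIntegral f s t J)
    (hfg : ∀ᵐ x : ℝ, min s t < x → (x : EReal) < max s t → f x = g x) :
    HasLaplaceIntegral g s t J := by
  rw [hasLaplaceIntegral_iff] at h ⊢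
  obtain ⟨Φ, hΦ, hJ⟩ := h
  exact ⟨Φ, hΦ.congr_ae hfg, hJ⟩

theorem unique (h1 : HasLaplaceIntegral f s t J) (h2 : HasLaplaceIntegral f s t K) : J = K := by
  rw [hasLaplaceIntegral_iff] at h1 h2
  obtain ⟨Φ, hΦ, rfl⟩ := h1
  obtain ⟨Ψ, hΨ, rfl⟩ := h2
  have := hΦ.unique hΨ min_le_max
  rcases le_total s t with hst | hst
  · rwa [min_eq_left hst, max_eq_right hst] at this
  · rw [min_eq_right hst, max_eq_left hst] at this
    linarith

theorem add (h1 : HasLaplaceIntegral f s t J) (h2 : HasLaplaceIntegral g s t K) :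
    HasLaplaceIntegral (fun x => f x + g x) s t (J + K) := by
  rw [hasLaplaceIntegral_iff] at h1 h2 ⊢
  obtain ⟨Φ, hΦ, rfl⟩ := h1
  obtain ⟨Ψ, hΨ, rfl⟩ := h2
  exact ⟨_, hΦ.add hΨ, by ring⟩

theorem sub (h1 : HasLaplaceIntegral f s t J) (h2 : HasLaplaceIntegral g s t K) :
    HasLaplaceIntegral (fun x => f x - g x) s t (J - K) := by
  rw [hasLaplaceIntegral_iff] at h1 h2 ⊢
  obtain ⟨Φ, hΦ, rfl⟩ := h1
  obtain ⟨Ψ, hΨ, rfl⟩ := h2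
  simp only [sub_eq_add_neg (f _)]
  exact ⟨_, hΦ.add hΨ.neg, by ring⟩

end HasLaplaceIntegral

/-- A single-valued graph forces any two representatives to agree a.e. -/
theorem HasLaplaceIntegralAE.eq_of_hasLaplaceIntegral {φ : ℝ → ℝ → Prop} {g : ℝ → ℝ} {s t : EReal}
    {J K : ℝ} (hφ : ∀ x v v', φ x v → φ x v' → v = v') (h1 : HasLaplaceIntegralAE φ s t J)
    (hg : ∀ᵐ x : ℝ, min s t < (x : EReal) → (x : EReal) < max s t → φ x (g x))
    (h2 : HasLaplaceIntegral g s t K) : J = K := by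
  obtain ⟨k, hk, hkJ⟩ := h1
  refine (hkJ.congr_ae ?_).unique h2
  filter_upwards [hk, hg] with x hx hx' h h'
  exact hφ x _ _ (hx h h') (hx' h h')

theorem HasLaplaceIntegralAE.unique {φ : ℝ → ℝ → Prop} {s t : EReal} {J K : ℝ}
    (hφ : ∀ x v v', φ x v → φ x v' → v = v') (h1 : HasLaplaceIntegralAE φ s t J)
    (h2 : HasLaplaceIntegralAE φ s t K) : J = K := by
  obtain ⟨g, hg, hgK⟩ := h2
  exact h1.eq_of_hasLaplaceIntegral hφ hg hgK

theorem PartialLaplaceDeriv.unique {f : EReal → EReal → ℝ} {x y v v' : ℝ}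
    (h : PartialLaplaceDeriv f x y v) (h' : PartialLaplaceDeriv f x y v') : v = v' :=
  HasLaplaceDeriv.unique (f := fun u : ℝ => f u y) h h'

/-! ### The equivalence. -/

theorem theorem4p1 (α β a b : EReal) (hαβ : α < β) (hab : a < b) (f : EReal → EReal → ℝ)
    (hf : ∀ᵐ y : ℝ, a < (y : EReal) → (y : EReal) < b →
      IsLPPrimitive (fun x : EReal => f x y) α β)
    (hF : ∃ x₀ ∈ Set.Icc α β, ∃ J : ℝ, HasLaplaceIntegral (fun y : ℝ => f x₀ y) a b J) :
    (∃ F : EReal → ℝ,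
      (∀ x ∈ Set.Icc α β, HasLaplaceIntegral (fun y : ℝ => f x y) a b (F x)) ∧
      IsLPPrimitive F α β ∧
      (∀ᵐ x : ℝ, α < (x : EReal) → (x : EReal) < β →
        ∃ L : ℝ, LaplaceDerivGraph F x L ∧
          HasLaplaceIntegralAE (fun y v => PartialLaplaceDeriv f x y v) a b L)) ↔
    (∀ s ∈ Set.Icc α β, ∀ t ∈ Set.Icc α β, ∃ K : ℝ,
      HasLaplaceIntegralAE
        (fun x w => HasLaplaceIntegralAE (fun y v => PartialLaplaceDeriv f x y v) a b w) s t K ∧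
      HasLaplaceIntegralAE
        (fun y w => HasLaplaceIntegralAE (fun x v => PartialLaplaceDeriv f x y v) s t w) a b K) := by
  have hfun : ∀ x w w', HasLaplaceIntegralAE (fun y v => PartialLaplaceDeriv f x y v) a b w →
      HasLaplaceIntegralAE (fun y v => PartialLaplaceDeriv f x y v) a b w' → w = w' :=
    fun x w w' h h' => HasLaplaceIntegralAE.unique
      (fun y v v' => PartialLaplaceDeriv.unique (f := f) (x := x) (y := y)) h h'
  have hbetween : ∀ s ∈ Icc α β, ∀ t ∈ Icc α β, ∀ x : EReal, min s t < x → x < max s t →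
      α < x ∧ x < β := fun s hs t ht x h1 h2 =>
    ⟨(le_min hs.1 ht.1).trans_lt h1, h2.trans_le (max_le hs.2 ht.2)⟩
  constructor
  · rintro ⟨F, hFint, hFP, hFD⟩ s hs t ht
    refine ⟨F t - F s, ?_, fun y => f t y - f s y, ?_, (hFint t ht).sub (hFint s hs)⟩
    · obtain ⟨g, hg, hgi⟩ := hFP.2.2.2 s hs t ht
      refine ⟨g, ?_, hgi⟩
      filter_upwards [hg, hFD] with x hx hxD h1 h2
      obtain ⟨h3, h4⟩ := hbetween s hs t ht x h1 h2
      obtain ⟨L, hL, hLi⟩ := hxD h3 h4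
      rwa [← HasLaplaceDeriv.unique hL (hx h1 h2)]
    · rw [min_eq_left hab.le, max_eq_right hab.le]
      filter_upwards [hf] with y hy h1 h2
      exact (hy h1 h2).2.2.2 s hs t ht
  · intro H
    have hdiff : ∀ s ∈ Icc α β, ∀ t ∈ Icc α β, ∃ K,
        HasLaplaceIntegralAE (fun x w =>
          HasLaplaceIntegralAE (fun y v => PartialLaplaceDeriv f x y v) a b w) s t K ∧
        HasLaplaceIntegral (fun y : ℝ => f t y - f s y) a b K := by
      intro s hs t ht
      obtain ⟨K, h1, g, hg, hgi⟩ := H s hs t ht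
      -- For a.e. `y` the inner integral is `f t y - f s y`, since `f(·, y)` is an LP-primitive.
      refine ⟨K, h1, hgi.congr_ae ?_⟩
      filter_upwards [hg, hf] with y hy hfy h1 h2
      refine HasLaplaceIntegralAE.unique (φ := fun x v => PartialLaplaceDeriv f x y v)
        (fun x v v' => PartialLaplaceDeriv.unique) (hy h1 h2) ((hfy ?_ ?_).2.2.2 s hs t ht)
      · rwa [min_eq_left hab.le] at h1
      · rwa [max_eq_right hab.le] at h2
    obtain ⟨x₀, hx₀, J, hJ⟩ := hF
    have hex : ∀ x, ∃ r, x ∈ Icc α β → HasLaplaceIntegral (fun y : ℝ => f x y) a b r := by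
      intro x
      by_cases hx : x ∈ Icc α β
      · obtain ⟨K, -, hK⟩ := hdiff x₀ hx₀ x hx
        exact ⟨J + K, fun _ => by simpa using hJ.add hK⟩
      · exact ⟨0, fun h => absurd h hx⟩
    choose F hFint using hex
    have hFK : ∀ s ∈ Icc α β, ∀ t ∈ Icc α β, HasLaplaceIntegralAE (fun x w =>
        HasLaplaceIntegralAE (fun y v => PartialLaplaceDeriv f x y v) a b w) s t (F t - F s) := by
      intro s hs t ht
      obtain ⟨K, h1, h2⟩ := hdiff s hs t ht
      rwa [← h2.unique ((hFint t ht).sub (hFint s hs))]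
    have hα : α ∈ Icc α β := ⟨le_rfl, hαβ.le⟩
    have hβ : β ∈ Icc α β := ⟨hαβ.le, le_rfl⟩
    -- One representative `h` of the inner `y`-integral on all of `[α, β]`; its primitive `Φ` will
    -- equal `F` up to a constant.
    obtain ⟨h, hh, hhi⟩ := hFK α hα β hβ
    obtain ⟨Φ, hΦ, -⟩ := hasLaplaceIntegral_iff.1 hhi
    rw [min_eq_left hαβ.le, max_eq_right hαβ.le] at hΦ hh
    have hFΦ : ∀ x ∈ Icc α β, F x = Φ x - Φ α + F α := by
      intro x hx
      have := (hFK α hα x hx).eq_of_hasLaplaceIntegral hfun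
        (hh.mono fun z hz h1 h2 => by
          obtain ⟨h3, h4⟩ := hbetween α hα x hx z h1 h2
          exact hz h3 h4)
        (Or.inl ⟨hx.1, (hΦ.restrict le_rfl hx.2).hasLaplaceIntegralIcc hx.1⟩)
      linarith
    have hFh : ∀ᵐ x : ℝ, α < (x : EReal) → (x : EReal) < β → LaplaceDerivGraph F x (h x) := by
      -- The fundamental theorem concerns compact intervals; countably many rational ones cover the
      -- open interval.
      have hrat : ∀ᵐ x : ℝ, ∀ p q : ℚ, α ≤ ((p : ℝ) : EReal) → p ≤ q → ((q : ℝ) : EReal) ≤ β →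
          x ∈ Ioo (p : ℝ) q → LaplaceDerivGraph F x (h x) := by
        refine ae_all_iff.2 fun p => ae_all_iff.2 fun q => ?_
        by_cases hpq : α ≤ ((p : ℝ) : EReal) ∧ p ≤ q ∧ ((q : ℝ) : EReal) ≤ β
        · filter_upwards [ae_hasLaplaceDeriv (h := h) (Φ := fun u : ℝ => F u)
            (Rat.cast_le.2 hpq.2.1) fun c d h1 h2 h3 => by
              have hc : α ≤ (c : EReal) := hpq.1.trans (EReal.coe_le_coe_iff.2 h1)
              have hd : (d : EReal) ≤ β := (EReal.coe_le_coe_iff.2 h3).trans hpq.2.2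
              have hcd : (c : EReal) ≤ d := EReal.coe_le_coe_iff.2 h2
              have := hΦ.integral c d hc h2 hd
              rw [hFΦ c ⟨hc, hcd.trans hd⟩, hFΦ d ⟨hc.trans hcd, hd⟩]
              simpa using this] with x hx _ _ _ hxm
          exact hx hxm
        · exact Eventually.of_forall fun x h1 h2 h3 => absurd ⟨h1, h2, h3⟩ hpq
      filter_upwards [hrat] with x hx h1 h2
      obtain ⟨p, hp1, hp2⟩ := EReal.lt_iff_exists_rat_btwn.1 h1
      obtain ⟨q, hq1, hq2⟩ := EReal.lt_iff_exists_rat_btwn.1 h2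
      have hpx : (p : ℝ) < x := EReal.coe_lt_coe_iff.1 hp2
      have hxq : x < (q : ℝ) := EReal.coe_lt_coe_iff.1 hq1
      exact hx p q hp1.le (Rat.cast_le.1 (hpx.trans hxq).le) hq2.le ⟨hpx, hxq⟩
    have hFint' : ∀ s ∈ Icc α β, ∀ t ∈ Icc α β,
        HasLaplaceIntegralAE (LaplaceDerivGraph F) s t (F t - F s) := by
      intro s hs t ht
      obtain ⟨g, hg, hgi⟩ := hFK s hs t ht
      refine ⟨g, ?_, hgi⟩
      filter_upwards [hg, hh, hFh] with x hx hhx hFx h1 h2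
      obtain ⟨h3, h4⟩ := hbetween s hs t ht x h1 h2
      -- Uniqueness of the inner integral identifies `g` with `h`, hence with the Laplace derivative
      -- of `F`.
      rw [hfun x _ _ (hx h1 h2) (hhx h3 h4)]
      exact hFx h3 h4
    refine ⟨F, fun x hx => hFint x hx, ⟨?_, ?_, ⟨_, hFint' α hα β hβ⟩, hFint'⟩, ?_⟩
    · exact ((hΦ.cont.sub continuousOn_const).add continuousOn_const).congr hFΦ
    · exact hFh.mono fun x hx h1 h2 => ⟨h x, hx h1 h2⟩
    · filter_upwards [hFh, hh] with x hx hhx h1 h2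
      exact ⟨h x, hx h1 h2, hhx h1 h2⟩
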